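/- Let $\mathbb T=(\mathbb R\cup\{-\infty\},\max,+)$ be the tropical semiring, let $k$ be a field with a non-archimedean valuation $\nu:k\to\mathbb T$ (multiplicative, $\nu(0)=-\infty$, $\nu(1)=0$, $\nu(-a)=\nu(a)$, $\nu(a+b)\le\max(\nu(a),\nu(b))$; the trivial valuation is allowed), and let $X$ be an integral scheme over $k$ with an open affine covering $\mathcal U$. *Universal tropicalization.* For a commutative monoid with zero $B$ and a semiring $S$, let $B\otimes_{\mathbb F_1}S$ be the $S$-algebra that is free as an $S$-module on monomials $x_b$, $0\neq b\in B$, with $x_ax_b=x_{ab}$ and $x_0=0$. Let $M(X)$ be the $\mathbb F_1$-scheme obtained by replacing the coordinate rings $A=\Gamma(V,\mathcal O_X)$ of the members of $\mathcal U$ and of their principal open subsets $V$ by their multiplicative monoids and gluing along common principal open subsets. The universal embedding $X\hookrightarrow\widehat X=M(X)\times_{\mathbb F_1}k$ is given on the patch of $V$ by the evaluation map $ev: A\otimes_{\mathbb F_1}k\to A$, $\sum\lambda_ax_a\mapsto\sum\lambda_aa$. The universal tropicalization $\mathrm{Trop}_{univ}(X)$ is the closed subscheme of the $\mathbb T$-scheme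 $M(X)\times_{\mathbb F_1}\mathbb T$ cut out on the patch of $V$ by the congruence generated by the bend relations $f\sim f_{\hat b}$ ($f_{\hat b}$ is $f$ with the term of $b$ deleted) for all monomials $b$ and all $f$ in the $\mathbb T$-linear span of the coefficientwise valuations of the elements of $\ker(ev)$. The set-theoretic tropicalization of $X$ in $\widehat X$ is the set of $\mathbb T$-points $q$ of $M(X)\times_{\mathbb F_1}\mathbb T$ such that, for each $\sum\lambda_ax_a\in\ker(ev)$ on a patch containing $q$, the maximum of the $q(\nu(\lambda_a)x_a)$ is $-\infty$ or is attained at least twice. *Analytification.* $X^{\mathrm{an}}$ is the set of pairs $z=(x,|\cdot|)$ of a point $x\in X$ and a non-archimedean absolute value on the residue field $\kappa(x)$ extending the absolute value $\exp\circ\nu$ of $k$, with the coarsest topology for which $z\mapsto x$ is continuous and $z\mapsto|f(x)|$ is continuous on the preimage of $U$ for every open $U\subseteq X$ and every $f\in\Gamma(U,\mathcal O_X)$. **Theorem A.** The inclusion of $\mathrm{Trop}_{univ}(X)(\mathbb T)$ into $(M(X)\times_{\mathbb F_1}\mathbb T)(\mathbb T)$ is injective, and its image is the set-theoretic tropicalization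 of $X$ in $\widehat X$. The sets $Z(\mathbb T)$, for $Z$ a closed subscheme (quasi-coherent congruence sheaf) of $\mathrm{Trop}_{univ}(X)$, are exactly the closed sets of a topology on $\mathrm{Trop}_{univ}(X)(\mathbb T)$, the strong Zariski topology. With this topology there is a unique homeomorphism $\mathrm{Trop}_{univ}(X)(\mathbb T)\to X^{\mathrm{an}}$ that sends a $\mathbb T$-point $\varphi$ of the patch of $V$ to a point $(x,|\cdot|)$ with $x\in V$ and $|f(x)|=\exp\varphi(x_f)$ for all $f\in\Gamma(V,\mathcal O_X)$. In particular, the set-theoretic tropicalization of $X$ in $\widehat X$ is canonically in bijection with $X^{\mathrm{an}}$. -/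

import Mathlib

open CategoryTheory AlgebraicGeometry

universe u v w

set_option linter.checkUnivs false

/-- The tropical semiring `(ℝ ∪ {-∞}, max, +)`. -/
def TropicalReal : Type := WithBot ℝ

namespace TropicalReal

noncomputable instance : LinearOrder TropicalReal := inferInstanceAs (LinearOrder (WithBot ℝ))

/-- The exponential `ℝ ∪ {-∞} → ℝ`, with `exp (-∞) = 0`. -/
noncomputable def exp (t : TropicalReal) : ℝ := WithBot.recBotCoe (C := fun _ => ℝ) 0 Real.exp t

noncomputable instance : Add TropicalReal := ⟨fun a b => max a b⟩
noncomputable instance : Zero TropicalReal := ⟨(⊥ : WithBot ℝ)⟩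
noncomputable instance : Mul TropicalReal :=
  ⟨fun a b => (show WithBot ℝ from a) + (show WithBot ℝ from b)⟩
noncomputable instance : One TropicalReal := ⟨(0 : WithBot ℝ)⟩

noncomputable instance : CommSemiring TropicalReal where
  nsmul := nsmulRec
  add_assoc a b c := max_assoc (α := WithBot ℝ) a b c
  zero_add a := max_eq_right (bot_le : (⊥ : WithBot ℝ) ≤ a)
  add_zero a := max_eq_left (bot_le : (⊥ : WithBot ℝ) ≤ a)
  add_comm a b := max_comm (α := WithBot ℝ) a b
  mul_assoc a b c := add_assoc (G := WithBot ℝ) a b c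
  one_mul a := zero_add (M := WithBot ℝ) a
  mul_one a := add_zero (M := WithBot ℝ) a
  mul_comm a b := add_comm (G := WithBot ℝ) a b
  zero_mul a := WithBot.bot_add (α := ℝ) a
  mul_zero a := WithBot.add_bot (α := ℝ) a
  left_distrib a b c := add_max (α := WithBot ℝ) a b c
  right_distrib a b c := max_add (α := WithBot ℝ) a b c

theorem add_def (a b : TropicalReal) : a + b = max a b := rfl

instance : IsLocalRing TropicalReal where
  exists_pair_ne := ⟨(⊥ : WithBot ℝ), (0 : WithBot ℝ), WithBot.bot_ne_coe⟩
  isUnit_or_isUnit_of_add_one {a b} h := by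
    rw [add_def] at h
    rcases max_choice a b with h' | h'
    · exact Or.inl (by rw [← h', h]; exact isUnit_one)
    · exact Or.inr (by rw [← h', h]; exact isUnit_one)

end TropicalReal

/-- A valuation on a ring `R` with values in an (idempotent) semiring `S`. -/
structure SemiringValuation (R : Type u) (S : Type v) [CommRing R] [CommSemiring S] where
  toFun : R → S
  map_zero : toFun 0 = 0
  map_one : toFun 1 = 1
  map_mul : ∀ a b, toFun (a * b) = toFun a * toFun b
  map_neg : ∀ a, toFun (-a) = toFun a
  subadditive : ∀ a b, toFun (a + b) + toFun a + toFun b = toFun a + toFun b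

/-- The scalar extension `B ⊗_{𝔽₁} S` of a monoid with zero `B`: the free `S`-module on the nonzero
elements of `B`, encoded as the finitely supported functions on `B` that vanish at `0`. -/
@[ext] structure ScalarExt (S : Type u) [CommSemiring S] (B : Type v) [CommMonoidWithZero B] where
  coeff : B →₀ S
  coeff_zero : coeff 0 = 0

namespace ScalarExt

section basic

variable {S : Type u} [CommSemiring S] {B : Type v} [CommMonoidWithZero B]

/-- The quotient map from the monoid algebra, which sets the monomial of `0 : B` to zero. -/
noncomputable def proj (f : MonoidAlgebra S B) : ScalarExt S B :=
  ⟨f.coeff.erase 0, Finsupp.erase_same⟩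

/-- The representative in the monoid algebra without a term at `0 : B`. -/
def toMA (f : ScalarExt S B) : MonoidAlgebra S B := .ofCoeff f.coeff

theorem toMA_coeff (f : ScalarExt S B) : f.toMA.coeff = f.coeff := rfl

theorem proj_toMA (f : ScalarExt S B) : proj f.toMA = f := by
  ext b
  by_cases hb : b = 0
  · subst hb; simp [proj, f.coeff_zero]
  · simp [proj, toMA, Finsupp.erase_ne hb]

theorem proj_surjective : Function.Surjective (proj : MonoidAlgebra S B → ScalarExt S B) :=
  fun f => ⟨f.toMA, f.proj_toMA⟩

theorem toMA_proj_add (f : MonoidAlgebra S B) :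
    (proj f).toMA + MonoidAlgebra.single 0 (f.coeff 0) = f := by
  ext b
  by_cases hb : b = 0
  · subst hb; simp [proj, toMA]
  · simp [proj, toMA]

noncomputable instance : Zero (ScalarExt S B) := ⟨proj 0⟩
noncomputable instance : One (ScalarExt S B) := ⟨proj 1⟩
noncomputable instance : Add (ScalarExt S B) :=
  ⟨fun f g => ⟨f.coeff + g.coeff, by simp [f.coeff_zero, g.coeff_zero]⟩⟩
noncomputable instance : Mul (ScalarExt S B) := ⟨fun f g => proj (f.toMA * g.toMA)⟩
noncomputable instance : SMul S (ScalarExt S B) :=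
  ⟨fun s f => ⟨s • f.coeff, by simp [f.coeff_zero]⟩⟩
noncomputable instance : SMul ℕ (ScalarExt S B) := ⟨fun n f => proj (n • f.toMA)⟩
noncomputable instance : Pow (ScalarExt S B) ℕ := ⟨fun f n => proj (f.toMA ^ n)⟩
noncomputable instance : NatCast (ScalarExt S B) := ⟨fun n => proj n⟩

theorem zero_coeff : (0 : ScalarExt S B).coeff = 0 := Finsupp.erase_zero 0

theorem coeff_add (f g : ScalarExt S B) : (f + g).coeff = f.coeff + g.coeff := rfl

theorem coeff_smul (s : S) (f : ScalarExt S B) : (s • f).coeff = s • f.coeff := rfl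

theorem proj_add (f g : MonoidAlgebra S B) : proj (f + g) = proj f + proj g := by
  ext b
  simp [proj, coeff_add, Finsupp.erase_add]

theorem proj_single_zero_mul (s : S) (f : MonoidAlgebra S B) :
    proj (MonoidAlgebra.single 0 s * f) = proj 0 := by
  induction f using MonoidAlgebra.induction_linear with
  | zero => simp
  | add f g hf hg => rw [mul_add, proj_add, hf, hg, ← proj_add, add_zero]
  | single b t =>
    rw [MonoidAlgebra.single_mul_single, zero_mul]
    simp only [proj, MonoidAlgebra.coeff_single, Finsupp.erase_single, MonoidAlgebra.coeff_zero,
      Finsupp.erase_zero]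

theorem proj_add_single_zero_mul (f g : MonoidAlgebra S B) (s : S) :
    proj ((f + MonoidAlgebra.single 0 s) * g) = proj (f * g) := by
  rw [add_mul, proj_add, proj_single_zero_mul, ← proj_add, add_zero]

theorem proj_mul (f g : MonoidAlgebra S B) : proj (f * g) = proj f * proj g := by
  conv_lhs => rw [← toMA_proj_add f, proj_add_single_zero_mul, mul_comm,
    ← toMA_proj_add g, proj_add_single_zero_mul, mul_comm]
  rfl

theorem proj_pow (f : MonoidAlgebra S B) (n : ℕ) : proj (f ^ n) = proj f ^ n := by
  change _ = proj ((proj f).toMA ^ n)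
  induction n with
  | zero => simp
  | succ n ih => rw [pow_succ, pow_succ, proj_mul, proj_mul, ih, proj_toMA]

theorem proj_nsmul (n : ℕ) (f : MonoidAlgebra S B) : proj (n • f) = n • proj f := by
  change _ = proj (n • (proj f).toMA)
  induction n with
  | zero => simp
  | succ n ih => rw [succ_nsmul, succ_nsmul, proj_add, proj_add, ih, proj_toMA]

noncomputable instance : CommSemiring (ScalarExt S B) :=
  Function.Surjective.commSemiring proj proj_surjective rfl rfl proj_add proj_mul
    (fun _ _ => proj_nsmul _ _) proj_pow (fun _ => rfl)

/-- `proj` as a ring homomorphism. -/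
noncomputable def projHom : MonoidAlgebra S B →+* ScalarExt S B where
  toFun := proj
  map_one' := rfl
  map_mul' := proj_mul
  map_zero' := rfl
  map_add' := proj_add

theorem proj_smul (s : S) (f : MonoidAlgebra S B) : proj (s • f) = s • proj f := by
  ext b
  by_cases hb : b = 0
  · subst hb; simp [proj, coeff_smul]
  · simp [proj, coeff_smul, Finsupp.erase_ne hb]

noncomputable instance : Algebra S (ScalarExt S B) where
  algebraMap := projHom.comp (algebraMap S (MonoidAlgebra S B))
  commutes' _ _ := mul_comm _ _
  smul_def' s f := by
    obtain ⟨f, rfl⟩ := proj_surjective f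
    rw [← proj_smul, Algebra.smul_def, proj_mul]; rfl

/-- The monomials `x_b`, satisfying `x_a x_b = x_{ab}`, `x_1 = 1` and `x_0 = 0`. -/
noncomputable def x : B →*₀ ScalarExt S B where
  toFun b := proj (MonoidAlgebra.single b 1)
  map_zero' := by
    change _ = proj 0
    ext c; simp [proj]
  map_one' := rfl
  map_mul' a b := by rw [← proj_mul, MonoidAlgebra.single_mul_single, one_mul]

/-- The universal property: a homomorphism of monoids with zero from `B` to an `S`-algebra extends
to `B ⊗_{𝔽₁} S`. -/
noncomputable def lift {D : Type w} [CommSemiring D] [Algebra S D] (g : B →*₀ D) :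
    ScalarExt S B →ₐ[S] D :=
  have key : ∀ f : MonoidAlgebra S B, MonoidAlgebra.lift S D B g (proj f).toMA =
      MonoidAlgebra.lift S D B g f := fun f => by
    conv_rhs => rw [← toMA_proj_add f, map_add]
    simp
  AlgHom.ofLinearMap
    { toFun := fun f => MonoidAlgebra.lift S D B g f.toMA
      map_add' := fun f h => map_add (MonoidAlgebra.lift S D B g) f.toMA h.toMA
      map_smul' := fun s f => map_smul (MonoidAlgebra.lift S D B g) s f.toMA }
    ((key 1).trans (map_one _))
    (fun f h => (key _).trans (map_mul _ _ _))

theorem lift_proj {D : Type w} [CommSemiring D] [Algebra S D] (g : B →*₀ D)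
    (f : MonoidAlgebra S B) : lift (S := S) g (proj f) = MonoidAlgebra.lift S D B g f := by
  change MonoidAlgebra.lift S D B g (proj f).toMA = _
  conv_rhs => rw [← toMA_proj_add f, map_add]
  simp

@[simp] theorem lift_x {D : Type w} [CommSemiring D] [Algebra S D] (g : B →*₀ D) (b : B) :
    lift (S := S) g (x b) = g b := by
  change lift (S := S) g (proj _) = _
  rw [lift_proj]; simp

theorem induction {P : ScalarExt S B → Prop} (f : ScalarExt S B) (zero : P 0)
    (add : ∀ f g, P f → P g → P (f + g)) (single : ∀ (s : S) (b : B), P (s • x b)) : P f := by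
  obtain ⟨f, rfl⟩ := proj_surjective f
  induction f using MonoidAlgebra.induction_linear with
  | zero => exact zero
  | add f g hf hg => rw [proj_add]; exact add _ _ hf hg
  | single b t =>
    have : (MonoidAlgebra.single b t : MonoidAlgebra S B) = t • MonoidAlgebra.single b 1 := by simp
    rw [this, proj_smul]; exact single t b

theorem algHom_ext {D : Type w} [CommSemiring D] [Algebra S D] {φ ψ : ScalarExt S B →ₐ[S] D}
    (h : ∀ b, φ (x b) = ψ (x b)) : φ = ψ := by
  ext f
  induction f using induction with
  | zero => simp
  | add f g hf hg => simp [hf, hg]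
  | single s b => simp [h]

/-- Functoriality of the scalar extension in the monoid. -/
noncomputable def map {C : Type w} [CommMonoidWithZero C] (φ : B →*₀ C) :
    ScalarExt S B →ₐ[S] ScalarExt S C :=
  lift ((x : C →*₀ ScalarExt S C).comp φ)

@[simp] theorem map_x {C : Type w} [CommMonoidWithZero C] (φ : B →*₀ C) (b : B) :
    map (S := S) φ (x b) = x (φ b) := by simp [map]

/-- Delete the monomial term of `b` from `f`. -/
noncomputable def erase (b : B) (f : ScalarExt S B) : ScalarExt S B :=
  ⟨f.coeff.erase b, by
    by_cases h : (0 : B) = b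
    · subst h; simp
    · rw [Finsupp.erase_ne h, f.coeff_zero]⟩

/-- Apply a map preserving zero to all coefficients. -/
noncomputable def mapCoeff {R : Type w} [CommSemiring R] (ν : R → S) (h0 : ν 0 = 0)
    (f : ScalarExt R B) : ScalarExt S B :=
  ⟨f.coeff.mapRange ν h0, by simp [f.coeff_zero, h0]⟩

end basic

end ScalarExt


/-- `φ` exhibits its target as the localization of its source at the powers of `f`; in geometric
terms, `φ` is the open immersion of a principal open subset. This notion is the same for monoids
and for semirings. -/
abbrev IsPrincipalLoc {A : Type u} {A' : Type v} [CommMonoid A] [CommMonoid A'] (f : A)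
    (φ : A → A') : Prop :=
  (Submonoid.powers f).IsLocalizationMap φ

theorem IsPrincipalLoc.exists_pow {A : Type u} {A' : Type v} [CommMonoid A] [CommMonoid A'] {f : A}
    {φ : A →* A'} (hφ : IsPrincipalLoc f φ) {s : A} (hs : IsUnit (φ s)) :
    ∃ (n : ℕ) (t : A), s * t = f ^ n := by
  obtain ⟨u, hu⟩ := hs
  obtain ⟨⟨t, ⟨_, m, rfl⟩⟩, ht⟩ := hφ.surj (↑u⁻¹ : A')
  have : φ (s * t) = φ (f ^ m) := by
    rw [map_mul, ← ht, ← hu, ← mul_assoc, Units.mul_inv, one_mul]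
  obtain ⟨⟨_, n, rfl⟩, hc⟩ := hφ.exists_of_eq this
  refine ⟨n + m, t * f ^ n, ?_⟩
  simp only at hc
  rw [pow_add, ← hc, ← mul_assoc, mul_comm]

/-- A scheme over `𝔽₁`, given by gluing the spectra of monoids with zero along principal open
subsets. The affine patches are indexed by `Chart`, and `i ≤ j` means that patch `i` is a principal
open subset of patch `j`. Two patches contained in a third one meet in a patch, and any two patches
are glued along the union of all the patches that lie below both. -/
structure F1Scheme where
  Chart : Type u
  [preorder : Preorder Chart]
  alg : Chart → Type v
  [monoid : ∀ i, CommMonoidWithZero (alg i)]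
  res : ∀ {i j : Chart}, i ≤ j → (alg j →*₀ alg i)
  res_refl : ∀ (i : Chart) (a : alg i), res (le_refl i) a = a
  res_trans : ∀ {i j l : Chart} (h : i ≤ j) (h' : j ≤ l) (a : alg l),
    res h (res h' a) = res (h.trans h') a
  inter : ∀ {i i' j : Chart} (h : i ≤ j) (h' : i' ≤ j),
    ∃ (b b' : alg j) (m : Chart) (hm : m ≤ i) (_ : m ≤ i'),
      IsPrincipalLoc b (res h) ∧ IsPrincipalLoc b' (res h') ∧
        IsPrincipalLoc (b * b') (res (hm.trans h))

attribute [instance] F1Scheme.preorder F1Scheme.monoid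

/-- Every patch is the spectrum of an integral monoid with zero, or is empty (the spectrum of the
zero monoid, which is allowed as a patch for convenience). -/
class F1Scheme.IsLocallyIntegral (Y : F1Scheme.{u, v}) : Prop where
  cancel : ∀ i, IsCancelMulZero (Y.alg i)

/-- A scheme over a semiring `S`, given by gluing the spectra of `S`-algebras along principal open
subsets, with the same conventions as for schemes over `𝔽₁`. -/
structure SemiringScheme (S : Type w) [CommSemiring S] where
  Chart : Type u
  [preorder : Preorder Chart]
  alg : Chart → Type v
  [semiring : ∀ i, CommSemiring (alg i)]
  [algebra : ∀ i, Algebra S (alg i)]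
  res : ∀ {i j : Chart}, i ≤ j → (alg j →ₐ[S] alg i)
  res_refl : ∀ (i : Chart) (a : alg i), res (le_refl i) a = a
  res_trans : ∀ {i j l : Chart} (h : i ≤ j) (h' : j ≤ l) (a : alg l),
    res h (res h' a) = res (h.trans h') a
  inter : ∀ {i i' j : Chart} (h : i ≤ j) (h' : i' ≤ j),
    ∃ (b b' : alg j) (m : Chart) (hm : m ≤ i) (_ : m ≤ i'),
      IsPrincipalLoc b (res h) ∧ IsPrincipalLoc b' (res h') ∧
        IsPrincipalLoc (b * b') (res (hm.trans h))

attribute [instance] SemiringScheme.preorder SemiringScheme.semiring SemiringScheme.algebra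

namespace SemiringScheme

variable {S : Type w} [CommSemiring S] (Y : SemiringScheme.{u, v, w} S)

theorem exists_principalLoc {i j : Y.Chart} (h : i ≤ j) : ∃ f, IsPrincipalLoc f (Y.res h) := by
  obtain ⟨b, _, _, _, _, hb, _⟩ := Y.inter h h
  exact ⟨b, hb⟩

/-- Two `T`-points of affine patches are identified if they come from a `T`-point of a patch that
lies below both. -/
def PointRel (T : Type*) [CommSemiring T] [Algebra S T] (p q : Σ i, Y.alg i →ₐ[S] T) : Prop :=
  ∃ (l : Y.Chart) (h : l ≤ p.1) (h' : l ≤ q.1) (χ : Y.alg l →ₐ[S] T),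
    χ.comp (Y.res h) = p.2 ∧ χ.comp (Y.res h') = q.2

/-- The set `Y(T)` of morphisms `Spec T ⟶ Y` over `S`, for a local semiring `T`. As every Zariski
covering of `Spec T` contains `Spec T` itself, a `T`-point of `Y` is a `T`-point of an affine
patch, up to gluing. -/
def Points (T : Type*) [CommSemiring T] [Algebra S T] [IsLocalRing T] : Type _ :=
  Quot (Y.PointRel T)

/-- The `T`-point of `Y` given by a `T`-point of an affine patch. -/
def point {T : Type*} [CommSemiring T] [Algebra S T] [IsLocalRing T] (i : Y.Chart)
    (φ : Y.alg i →ₐ[S] T) : Y.Points T :=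
  Quot.mk _ ⟨i, φ⟩

/-- A closed subscheme of a semiring scheme: a quasi-coherent sheaf of congruences, i.e. a
congruence on the algebra of every patch, such that the congruence on a smaller patch is the
localization of the one on a larger patch. -/
structure ClosedSubscheme where
  con : ∀ i, RingCon (Y.alg i)
  quasiCoherent : ∀ {i j : Y.Chart} (h : i ≤ j) (a b : Y.alg j),
    con i (Y.res h a) (Y.res h b) ↔ ∃ s, IsUnit (Y.res h s) ∧ con j (s * a) (s * b)

namespace ClosedSubscheme

variable {Y}

theorem con_res_iff (Z : Y.ClosedSubscheme) {i j : Y.Chart} (h : i ≤ j) {f : Y.alg j}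
    (hf : IsPrincipalLoc f (Y.res h)) (a b : Y.alg j) :
    Z.con i (Y.res h a) (Y.res h b) ↔ ∃ n : ℕ, Z.con j (f ^ n * a) (f ^ n * b) := by
  rw [Z.quasiCoherent]
  constructor
  · rintro ⟨s, hs, hab⟩
    obtain ⟨n, t, hst⟩ := IsPrincipalLoc.exists_pow (φ := (Y.res h : Y.alg j →* Y.alg i)) hf hs
    refine ⟨n, ?_⟩
    rw [← hst, mul_comm s t, mul_assoc, mul_assoc]
    exact (Z.con j).mul ((Z.con j).refl t) hab
  · rintro ⟨n, hn⟩
    exact ⟨f ^ n, hf.map_units ⟨_, n, rfl⟩, hn⟩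

theorem con_res (Z : Y.ClosedSubscheme) {i j : Y.Chart} (h : i ≤ j) {a b : Y.alg j}
    (hab : Z.con j a b) : Z.con i (Y.res h a) (Y.res h b) :=
  (Z.quasiCoherent h a b).2 ⟨1, by simp, by simpa using hab⟩

/-- Restriction between the affine patches of a closed subscheme. -/
noncomputable def resQuot (Z : Y.ClosedSubscheme) {i j : Y.Chart} (h : i ≤ j) :
    (Z.con j).Quotient →ₐ[S] (Z.con i).Quotient where
  toRingHom := (Z.con j).lift ((Z.con i).mk'.comp (Y.res h : Y.alg j →+* Y.alg i))
    (fun _ _ hab => (Z.con i).eq.2 (Z.con_res h hab))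
  commutes' s := by
    change (((Y.res h) (algebraMap S _ s) : Y.alg i) : (Z.con i).Quotient) = _
    rw [AlgHom.commutes]; rfl

theorem resQuot_coe (Z : Y.ClosedSubscheme) {i j : Y.Chart} (h : i ≤ j) (a : Y.alg j) :
    Z.resQuot h (a : (Z.con j).Quotient) = (Y.res h a : (Z.con i).Quotient) := rfl

theorem isPrincipalLoc_resQuot (Z : Y.ClosedSubscheme) {i j : Y.Chart} (h : i ≤ j) {f : Y.alg j}
    (hf : IsPrincipalLoc f (Y.res h)) :
    IsPrincipalLoc (f : (Z.con j).Quotient) (Z.resQuot h) where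
  map_units := by
    rintro ⟨_, n, rfl⟩
    exact (hf.map_units ⟨_, n, rfl⟩).map (Z.con i).mk'
  surj z := by
    induction z using Quotient.inductionOn with | _ z =>
    obtain ⟨⟨a, ⟨_, n, rfl⟩⟩, ha⟩ := hf.surj z
    exact ⟨⟨a, ⟨_, n, rfl⟩⟩, congrArg (Z.con i).mk' ha⟩
  exists_of_eq {a b} hab := by
    induction a using Quotient.inductionOn with | _ a =>
    induction b using Quotient.inductionOn with | _ b =>
    obtain ⟨n, hn⟩ := (Z.con_res_iff h hf a b).1 ((Z.con i).eq.1 hab)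
    exact ⟨⟨_, n, rfl⟩, (Z.con j).eq.2 hn⟩

/-- A closed subscheme, regarded as a scheme over `S`. -/
noncomputable abbrev toScheme (Z : Y.ClosedSubscheme) : SemiringScheme.{u, v, w} S where
  Chart := Y.Chart
  alg i := (Z.con i).Quotient
  res h := Z.resQuot h
  res_refl i a := by
    induction a using Quotient.inductionOn with | _ a =>
    exact congrArg (Z.con i).mk' (Y.res_refl i a)
  res_trans {i _ _} h h' a := by
    induction a using Quotient.inductionOn with | _ a =>
    exact congrArg (Z.con i).mk' (Y.res_trans h h' a)
  inter h h' := by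
    obtain ⟨b, b', m, hm, hm', hb, hb', hbb'⟩ := Y.inter h h'
    exact ⟨b, b', m, hm, hm', Z.isPrincipalLoc_resQuot h hb, Z.isPrincipalLoc_resQuot h' hb',
      Z.isPrincipalLoc_resQuot _ hbb'⟩

/-- The quotient map onto the algebra of an affine patch of a closed subscheme. -/
noncomputable def quotMap (Z : Y.ClosedSubscheme) (i : Y.Chart) :
    Y.alg i →ₐ[S] (Z.con i).Quotient :=
  { (Z.con i).mk' with commutes' := fun _ => rfl }

/-- The inclusion of `Z(T)` into `Y(T)`. -/
noncomputable def incl (Z : Y.ClosedSubscheme) (T : Type*) [CommSemiring T] [Algebra S T]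
    [IsLocalRing T] : Z.toScheme.Points T → Y.Points T :=
  Quot.map (fun p => ⟨p.1, p.2.comp (Z.quotMap p.1)⟩) (by
    rintro p q ⟨l, h, h', χ, hp, hq⟩
    exact ⟨l, h, h', χ.comp (Z.quotMap l),
      congrArg (fun θ => AlgHom.comp θ (Z.quotMap p.1)) hp,
      congrArg (fun θ => AlgHom.comp θ (Z.quotMap q.1)) hq⟩)

/-- The subset `Z(T)` of `Y(T)`. -/
def points (Z : Y.ClosedSubscheme) (T : Type*) [CommSemiring T] [Algebra S T] [IsLocalRing T] :
    Set (Y.Points T) :=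
  Set.range (Z.incl T)

end ClosedSubscheme

/-- The strong Zariski topology on `Y(S)`, in which the sets `Z(S)` are closed for all closed
subschemes `Z` of `Y`. -/
instance strongZariski [IsLocalRing S] : TopologicalSpace (Y.Points S) :=
  TopologicalSpace.generateFrom {O | ∃ Z : Y.ClosedSubscheme, O = (Z.points S)ᶜ}

end SemiringScheme

namespace ScalarExt

section localization

variable {S : Type u} [CommSemiring S] {B : Type v} [CommMonoidWithZero B]
  {C : Type w} [CommMonoidWithZero C]

theorem isPrincipalLoc_map {φ : B →*₀ C} {b : B} (hφ : IsPrincipalLoc b φ) :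
    IsPrincipalLoc (x b : ScalarExt S B) (map (S := S) φ) where
  map_units := by
    rintro ⟨_, n, rfl⟩
    have := (hφ.map_units ⟨_, 1, rfl⟩).map (x : C →*₀ ScalarExt S C)
    simpa using this.pow n
  surj z := by
    suffices ∃ (n : ℕ) (f : ScalarExt S B), z * map φ (x b ^ n) = map φ f by
      obtain ⟨n, f, h⟩ := this
      exact ⟨⟨f, ⟨_, n, rfl⟩⟩, h⟩
    induction z using induction with
    | zero => exact ⟨0, 0, by simp⟩
    | add f g hf hg =>
      obtain ⟨n, f', hf⟩ := hf
      obtain ⟨m, g', hg⟩ := hg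
      refine ⟨n + m, f' * x b ^ m + g' * x b ^ n, ?_⟩
      rw [map_add, map_mul, map_mul, ← hf, ← hg, pow_add, map_mul]
      ring
    | single s c =>
      obtain ⟨⟨a, ⟨_, n, rfl⟩⟩, ha⟩ := hφ.surj c
      refine ⟨n, s • x a, ?_⟩
      simp only at ha
      rw [map_smul, map_x, ← ha, map_mul, map_pow, map_pow, map_pow, map_x, smul_mul_assoc]
  exists_of_eq {f g} hfg := by
    let L := Localization.Away (x b : ScalarExt S B)
    let ι : B →*₀ L := (algebraMap (ScalarExt S B) L).toMonoidWithZeroHom.comp x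
    let loc : (Submonoid.powers b).LocalizationMap C :=
      { toFun := φ, map_mul' := map_mul φ, isLocalizationMap := hφ }
    have hι : ∀ y : Submonoid.powers b, IsUnit ((ι : B →* L) y) := by
      rintro ⟨_, n, rfl⟩
      have : IsUnit (algebraMap (ScalarExt S B) L (x b)) :=
        IsLocalization.map_units L ⟨x b, Submonoid.mem_powers _⟩
      have h2 := this.pow n
      rw [← map_pow, ← map_pow] at h2
      exact h2
    have hlift : ∀ a, loc.lift hι (φ a) = ι a := fun a => loc.lift_eq hι a
    let ψ : C →*₀ L :=
      { loc.lift hι with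
        map_zero' := by
          have := hlift 0
          simpa using this }
    have key : ∀ f, lift (S := S) ψ (map φ f) = algebraMap (ScalarExt S B) L f := by
      intro f
      have : (lift (S := S) ψ).comp (map φ) = IsScalarTower.toAlgHom S (ScalarExt S B) L :=
        algHom_ext fun a => by
          change lift (S := S) ψ (map φ (x a)) = algebraMap (ScalarExt S B) L (x a)
          rw [map_x, lift_x]
          exact hlift a
      exact congrArg (fun θ => θ f) this
    have : algebraMap (ScalarExt S B) L f = algebraMap (ScalarExt S B) L g := by
      rw [← key, ← key, hfg]
    exact (IsLocalization.eq_iff_exists (Submonoid.powers (x b : ScalarExt S B)) L).1 this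

end localization

end ScalarExt

/-- The base change `Y ×_{𝔽₁} S` of a scheme over `𝔽₁`. -/
noncomputable abbrev F1Scheme.baseChange (Y : F1Scheme.{u, v}) (S : Type w) [CommSemiring S] :
    SemiringScheme.{u, max v w, w} S where
  Chart := Y.Chart
  alg i := ScalarExt S (Y.alg i)
  res h := ScalarExt.map (Y.res h)
  res_refl i a := by
    have : ScalarExt.map (S := S) (Y.res (le_refl i)) = AlgHom.id S _ :=
      ScalarExt.algHom_ext fun b => by simp [Y.res_refl]
    exact congrArg (fun θ => θ a) this
  res_trans {i j l} h h' a := by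
    have : (ScalarExt.map (S := S) (Y.res h)).comp (ScalarExt.map (Y.res h')) =
        ScalarExt.map (Y.res (h.trans h')) :=
      ScalarExt.algHom_ext fun b => by simp [Y.res_trans]
    exact congrArg (fun θ => θ a) this
  inter h h' := by
    obtain ⟨b, b', m, hm, hm', hb, hb', hbb'⟩ := Y.inter h h'
    refine ⟨ScalarExt.x b, ScalarExt.x b', m, hm, hm', ScalarExt.isPrincipalLoc_map hb,
      ScalarExt.isPrincipalLoc_map hb', ?_⟩
    rw [← map_mul]
    exact ScalarExt.isPrincipalLoc_map hbb'


namespace ScalarExt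

section tropical

variable {R : Type*} [CommRing R] {S : Type*} [CommSemiring S] {B : Type*} [CommMonoidWithZero B]
  {C : Type*} [CommMonoidWithZero C]

/-- Relabel the monomials along an injective map preserving zero. -/
noncomputable def relabel (h : B → C) (hi : Function.Injective h) (h0 : h 0 = 0)
    (f : ScalarExt S B) : ScalarExt S C :=
  ⟨f.coeff.mapDomain h, by
    rw [← h0, Finsupp.mapDomain_apply hi, f.coeff_zero]⟩

theorem map_eq_relabel (φ : B →*₀ C) (hi : Function.Injective φ) (f : ScalarExt S B) :
    map φ f = relabel φ hi (map_zero φ) f := by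
  induction f using induction with
  | zero => ext c; simp [relabel, zero_coeff]
  | add f g hf hg =>
    rw [map_add, hf, hg]
    ext c
    simp [relabel, coeff_add, Finsupp.mapDomain_add]
  | single s b =>
    rw [map_smul, map_x]
    by_cases hb : b = 0
    · subst hb
      ext c
      simp [relabel, coeff_smul, x, proj]
    · have hb' : φ b ≠ 0 := fun h => hb (hi (h.trans (map_zero φ).symm))
      ext c
      simp [relabel, coeff_smul, x, proj, hb, hb', Finsupp.mapDomain_single]

theorem x_mul_eq_relabel (b : B) (hi : Function.Injective (b * ·)) (f : ScalarExt S B) :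
    x b * f = relabel (b * ·) hi (mul_zero b) f := by
  induction f using induction with
  | zero => ext c; simp [relabel, zero_coeff]
  | add f g hf hg =>
    rw [mul_add, hf, hg]
    ext c
    simp [relabel, coeff_add, Finsupp.mapDomain_add]
  | single s a =>
    rw [mul_smul_comm, ← map_mul]
    by_cases ha : a = 0
    · subst ha
      ext c
      simp [relabel, coeff_smul, x, proj]
    · have ha' : b * a ≠ 0 := fun h => ha (hi (h.trans (mul_zero b).symm))
      ext c
      simp [relabel, coeff_smul, x, proj, ha, ha', Finsupp.mapDomain_single]

theorem relabel_erase (h : B → C) (hi : Function.Injective h) (h0 : h 0 = 0) (b : B)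
    (f : ScalarExt S B) : relabel h hi h0 (erase b f) = erase (h b) (relabel h hi h0 f) := by
  ext c
  by_cases hc : c ∈ Set.range h
  · obtain ⟨a, rfl⟩ := hc
    by_cases hab : a = b
    · subst hab; simp [relabel, erase, Finsupp.mapDomain_apply hi]
    · simp [relabel, erase, Finsupp.mapDomain_apply hi, Finsupp.erase_ne hab,
        Finsupp.erase_ne (hi.ne hab)]
  · have hcb : c ≠ h b := fun e => hc ⟨b, e.symm⟩
    simp [relabel, erase, Finsupp.mapDomain_of_notMem_range _ _ hc, Finsupp.erase_ne hcb]

theorem relabel_mapCoeff (ν : R → S) (ν0 : ν 0 = 0) (h : B → C) (hi : Function.Injective h)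
    (h0 : h 0 = 0) (f : ScalarExt R B) :
    relabel h hi h0 (mapCoeff ν ν0 f) = mapCoeff ν ν0 (relabel h hi h0 f) := by
  ext c
  by_cases hc : c ∈ Set.range h
  · obtain ⟨a, rfl⟩ := hc
    simp [relabel, mapCoeff, Finsupp.mapDomain_apply hi]
  · simp [relabel, mapCoeff, Finsupp.mapDomain_of_notMem_range _ _ hc, ν0]

/-- The tropicalization of an ideal `I`: the `S`-linear span of the coefficientwise valuations of
the elements of `I`. -/
noncomputable def trop (ν : SemiringValuation R S) (I : Set (ScalarExt R B)) :
    Submodule S (ScalarExt S B) :=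
  Submodule.span S (mapCoeff ν.toFun ν.map_zero '' I)

/-- The congruence generated by the bend relations `f ∼ f - (term of b)` for `f ∈ J` and for
monomials `b`. (If `b` does not occur in `f`, the relation is trivial.) -/
noncomputable def bend (J : Submodule S (ScalarExt S B)) : RingCon (ScalarExt S B) :=
  ringConGen fun p q => ∃ f ∈ J, ∃ b, p = f ∧ q = erase b f

end tropical

end ScalarExt

namespace RingCon

/-- The localization of a congruence. -/
def localize {A A' : Type*} [CommSemiring A] [CommSemiring A'] (c : RingCon A) (φ : A →+* A')
    {f : A} (hφ : IsPrincipalLoc f φ) : RingCon A' where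
  r y z := ∃ (s a b : A), IsUnit (φ s) ∧ φ s * y = φ a ∧ φ s * z = φ b ∧ c a b
  iseqv :=
    { refl := fun y => by
        obtain ⟨⟨a, s⟩, h⟩ := hφ.surj y
        exact ⟨s, a, a, hφ.map_units s, by rw [mul_comm]; exact h, by rw [mul_comm]; exact h,
          c.refl a⟩
      symm := fun ⟨s, a, b, hs, ha, hb, hab⟩ => ⟨s, b, a, hs, hb, ha, c.symm hab⟩
      trans := by
        rintro y z w ⟨s, a, b, hs, ha, hb, hab⟩ ⟨s', b', d, hs', hb', hd, hbd⟩
        have : φ (s' * b) = φ (s * b') := by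
          rw [map_mul, map_mul, ← hb, ← hb']; ring
        obtain ⟨t, ht⟩ := hφ.exists_of_eq this
        refine ⟨t * (s * s'), t * (s' * a), t * (s * d), ?_, ?_, ?_, ?_⟩
        · rw [map_mul, map_mul]; exact (hφ.map_units t).mul (hs.mul hs')
        · simp only [map_mul]; rw [← ha]; ring
        · simp only [map_mul]; rw [← hd]; ring
        · refine c.trans (c.mul (c.refl _) (c.mul (c.refl _) hab)) ?_
          rw [ht]
          exact c.mul (c.refl _) (c.mul (c.refl _) hbd) }
  add' := by
    rintro y z y' z' ⟨s, a, b, hs, ha, hb, hab⟩ ⟨s', a', b', hs', ha', hb', hab'⟩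
    refine ⟨s * s', s' * a + s * a', s' * b + s * b', ?_, ?_, ?_, ?_⟩
    · rw [map_mul]; exact hs.mul hs'
    · simp only [map_mul, map_add]; rw [← ha, ← ha']; ring
    · simp only [map_mul, map_add]; rw [← hb, ← hb']; ring
    · exact c.add (c.mul (c.refl _) hab) (c.mul (c.refl _) hab')
  mul' := by
    rintro y z y' z' ⟨s, a, b, hs, ha, hb, hab⟩ ⟨s', a', b', hs', ha', hb', hab'⟩
    refine ⟨s * s', a * a', b * b', ?_, ?_, ?_, ?_⟩
    · rw [map_mul]; exact hs.mul hs'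
    · simp only [map_mul]; rw [← ha, ← ha']; ring
    · simp only [map_mul]; rw [← hb, ← hb']; ring
    · exact c.mul hab hab'

end RingCon

namespace F1Scheme

open ScalarExt

variable {R : Type*} [CommRing R] {S : Type*} [CommSemiring S]

theorem trop_localize {B C : Type*} [CommMonoidWithZero B] [CommMonoidWithZero C]
    [IsCancelMulZero B] (ν : SemiringValuation R S) (φ : B →*₀ C)
    {b : B} (hφ : IsPrincipalLoc b φ) (I : Set (ScalarExt R B)) (I' : Set (ScalarExt R C))
    (hmul : ∀ f ∈ I, ∀ g, g * f ∈ I)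
    (hI : ∀ f, map φ f ∈ I' ↔ ∃ n : ℕ, x b ^ n * f ∈ I)
    (hmul' : ∀ f ∈ I', ∀ g, g * f ∈ I') (f g : ScalarExt S B) :
    bend (trop ν I') (map φ f) (map φ g) ↔
      ∃ s, IsUnit (map (S := S) φ s) ∧ bend (trop ν I) (s * f) (s * g) := by
  have hloc := isPrincipalLoc_map (S := S) hφ
  by_cases hb : b = 0
  · subst hb
    have h0 : IsUnit (0 : ScalarExt S C) := by
      have := hloc.map_units ⟨_, 1, rfl⟩
      simpa using this
    have : Subsingleton (ScalarExt S C) := isUnit_zero_iff.1 h0 |> subsingleton_of_zero_eq_one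
    constructor
    · intro _
      exact ⟨0, by simpa using h0, by simpa using (bend (trop ν I)).refl 0⟩
    · intro _
      rw [Subsingleton.elim (map φ f) (map φ g)]
      exact (bend (trop ν I')).refl _
  have hpow : ∀ n : ℕ, Function.Injective ((b ^ n) * · : B → B) := fun n =>
    mul_right_injective₀ (pow_ne_zero n hb)
  have hi : Function.Injective φ := fun a a' h => by
    obtain ⟨⟨_, n, rfl⟩, hn⟩ := hφ.exists_of_eq h
    exact hpow n hn
  have hu : ∀ n : ℕ, IsUnit (φ b ^ n) := fun n => by
    simpa using hφ.map_units ⟨_, n, rfl⟩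
  have hpow' : ∀ n : ℕ, Function.Injective ((φ b ^ n) * · : C → C) := fun n =>
    (hu n).mul_right_injective
  -- the tropicalized ideals are stable under multiplication by powers of `x b`
  have hstab : ∀ (n : ℕ), ∀ p ∈ trop ν I, x b ^ n * p ∈ trop ν I := by
    intro n p hp
    induction hp using Submodule.span_induction with
    | mem p hp =>
      obtain ⟨h, hh, rfl⟩ := hp
      refine Submodule.subset_span ⟨x b ^ n * h, hmul h hh _, ?_⟩
      rw [← map_pow, ← map_pow, x_mul_eq_relabel _ (hpow n), x_mul_eq_relabel _ (hpow n),
        relabel_mapCoeff]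
    | zero => rw [mul_zero]; exact Submodule.zero_mem _
    | add p q _ _ hp hq => rw [mul_add]; exact Submodule.add_mem _ hp hq
    | smul s p _ hp => rw [mul_smul_comm]; exact Submodule.smul_mem _ _ hp
  have hres : ∀ p ∈ trop ν I, map φ p ∈ trop ν I' := by
    intro p hp
    induction hp using Submodule.span_induction with
    | mem p hp =>
      obtain ⟨h, hh, rfl⟩ := hp
      refine Submodule.subset_span ⟨map φ h, (hI h).2 ⟨0, by simpa using hh⟩, ?_⟩
      rw [map_eq_relabel _ hi, map_eq_relabel _ hi, relabel_mapCoeff]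
    | zero => rw [map_zero]; exact Submodule.zero_mem _
    | add p q _ _ hp hq => rw [map_add]; exact Submodule.add_mem _ hp hq
    | smul s p _ hp => rw [map_smul]; exact Submodule.smul_mem _ _ hp
  have hlift : ∀ p ∈ trop ν I', ∃ (n : ℕ), ∃ q ∈ trop ν I, map φ (x b ^ n) * p = map φ q := by
    intro p hp
    induction hp using Submodule.span_induction with
    | mem p hp =>
      obtain ⟨h, hh, rfl⟩ := hp
      obtain ⟨⟨h', ⟨_, n, rfl⟩⟩, hn⟩ := (isPrincipalLoc_map (S := R) hφ).surj h
      simp only at hn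
      obtain ⟨m, hm⟩ := (hI h').1 (by rw [← hn, mul_comm]; exact hmul' h hh _)
      refine ⟨n + m, _, Submodule.subset_span ⟨_, hm, rfl⟩, ?_⟩
      have e : map φ (x b ^ m * h') = x (φ b ^ (n + m)) * h := by
        rw [map_mul, ← hn]; simp only [map_pow, map_x]; ring
      rw [map_eq_relabel φ hi (mapCoeff _ _ _), relabel_mapCoeff, ← map_eq_relabel φ hi, e,
        x_mul_eq_relabel _ (hpow' _), ← relabel_mapCoeff, ← x_mul_eq_relabel]
      simp only [map_pow, map_x]
    | zero => exact ⟨0, 0, Submodule.zero_mem _, by simp⟩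
    | add p q _ _ hp hq =>
      obtain ⟨n, p', hp', hp⟩ := hp
      obtain ⟨m, q', hq', hq⟩ := hq
      refine ⟨n + m, x b ^ m * p' + x b ^ n * q',
        Submodule.add_mem _ (hstab _ _ hp') (hstab _ _ hq'), ?_⟩
      rw [map_add, map_mul, map_mul, ← hp, ← hq, pow_add, map_mul]
      ring
    | smul s p _ hp =>
      obtain ⟨n, p', hp', hp⟩ := hp
      exact ⟨n, s • p', Submodule.smul_mem _ _ hp', by rw [mul_smul_comm, hp, map_smul]⟩
  constructor
  · intro hfg
    have hle : bend (trop ν I') ≤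
        (bend (trop ν I)).localize (map (S := S) φ : ScalarExt S B →+* ScalarExt S C) hloc := by
      refine RingCon.ringConGen_le.2 ?_
      rintro p _ ⟨_, hp, c, rfl, rfl⟩
      obtain ⟨n, q, hq, hn⟩ := hlift p hp
      obtain ⟨⟨c', ⟨_, m, rfl⟩⟩, hm⟩ := hφ.surj c
      simp only at hm
      refine ⟨x b ^ (n + m), x b ^ m * q, erase (b ^ n * c') (x b ^ m * q), ?_, ?_, ?_, ?_⟩
      · exact hloc.map_units ⟨_, n + m, rfl⟩
      · change map φ (x b ^ (n + m)) * p = map φ (x b ^ m * q)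
        rw [map_mul, ← hn, pow_add, map_mul]; ring
      · change map φ (x b ^ (n + m)) * erase c p = map φ (erase _ (x b ^ m * q))
        have e1 : map φ (x b ^ m * q) = x (φ b ^ (n + m)) * p := by
          rw [map_mul, ← hn]; simp only [map_pow, map_x]; ring
        have e2 : φ (b ^ n * c') = φ b ^ (n + m) * c := by
          rw [map_mul, ← hm]; simp only [map_pow]
          rw [pow_add, mul_comm c, mul_assoc]
        rw [map_eq_relabel φ hi (erase _ _), relabel_erase, ← map_eq_relabel φ hi, e1, e2,
          map_pow, map_x, ← map_pow, x_mul_eq_relabel _ (hpow' _), x_mul_eq_relabel _ (hpow' _),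
          relabel_erase]
      · exact RingConGen.Rel.of _ _ ⟨_, hstab m q hq, _, rfl, rfl⟩
    obtain ⟨s, a, a', hs, ha, ha', haa'⟩ := hle hfg
    change IsUnit (map φ s) at hs
    change map φ s * map φ f = map φ a at ha
    change map φ s * map φ g = map φ a' at ha'
    rw [← map_mul] at ha ha'
    obtain ⟨t, ht⟩ := hloc.exists_of_eq ha
    obtain ⟨t', ht'⟩ := hloc.exists_of_eq ha'
    refine ⟨t * t' * s, ?_, ?_⟩
    · rw [map_mul, map_mul]
      exact ((hloc.map_units t).mul (hloc.map_units t')).mul hs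
    · have e1 : (t : ScalarExt S B) * t' * s * f = t' * t * a := by
        rw [mul_assoc (t' : ScalarExt S B), ← ht]; ring
      have e2 : (t : ScalarExt S B) * t' * s * g = t' * t * a' := by
        rw [mul_comm (t' : ScalarExt S B), mul_assoc (t : ScalarExt S B) t' a', ← ht']; ring
      rw [e1, e2]
      exact (bend (trop ν I)).mul ((bend (trop ν I)).refl _) haa'
  · rintro ⟨s, hs, hfg⟩
    have hle : bend (trop ν I) ≤
        (bend (trop ν I')).comap (map (S := S) φ : ScalarExt S B →+* ScalarExt S C) := by
      refine RingCon.ringConGen_le.2 ?_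
      rintro p _ ⟨_, hp, c, rfl, rfl⟩
      refine RingConGen.Rel.of _ _ ⟨map φ p, hres p hp, φ c, rfl, ?_⟩
      change map φ (erase c p) = _
      rw [map_eq_relabel φ hi, map_eq_relabel φ hi, relabel_erase]
    have h1 : bend (trop ν I') (map φ (s * f)) (map φ (s * g)) := hle hfg
    rw [map_mul (map φ), map_mul (map φ)] at h1
    obtain ⟨w, hw⟩ := hs
    have h2 := (bend (trop ν I')).mul ((bend (trop ν I')).refl (↑w⁻¹ : ScalarExt S C)) h1
    rwa [← hw, ← mul_assoc, ← mul_assoc, Units.inv_mul, one_mul, one_mul] at h2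


/-- The scheme-theoretic tropicalization of a closed subscheme `X` of `Y ×_{𝔽₁} R` for a locally
integral scheme `Y` over `𝔽₁`: the closed subscheme of `Y ×_{𝔽₁} S` that is cut out on every patch
by the bend relations of the tropicalization of the ideal of `X`. -/
noncomputable def tropicalization (Y : F1Scheme.{u, v}) [hY : Y.IsLocallyIntegral]
    (ν : SemiringValuation R S) (X : (Y.baseChange R).ClosedSubscheme) :
    (Y.baseChange S).ClosedSubscheme where
  con i := bend (trop ν {f : ScalarExt R (Y.alg i) | X.con i f 0})
  quasiCoherent {i j} h a b := by
    have := hY.cancel j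
    obtain ⟨b₀, _, _, _, _, hb₀, _⟩ := Y.inter h h
    have hmul : ∀ (l : Y.Chart) (f : ScalarExt R (Y.alg l)), X.con l f 0 →
        ∀ g, X.con l (g * f) 0 := fun l f hf g => by
      have := (X.con l).mul ((X.con l).refl g) hf
      rwa [mul_zero] at this
    refine trop_localize ν (Y.res h) hb₀ _ _ (hmul j) (fun f => ?_) (hmul i) a b
    have := X.con_res_iff h (isPrincipalLoc_map (S := R) hb₀) f 0
    rw [map_zero] at this
    refine this.trans (exists_congr fun n => ?_)
    rw [mul_zero]; rfl

/-- The maximum of a family of tropical numbers is `-∞` or is attained at least twice. -/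
def MaxAttainedTwice {ι : Type*} (t : ι → TropicalReal) : Prop :=
  (∀ b, t b = 0) ∨ ∃ b b', b ≠ b' ∧ t b = t b' ∧ ∀ c, t c ≤ t b

/-- The set-theoretic tropicalization of a closed subscheme `X` of `Y ×_{𝔽₁} R`: the set of those
tropical points `q` of `Y ×_{𝔽₁} 𝕋` such that, for every `∑ λ_b x_b` in the ideal of `X`, the
maximum of the `q (ν(λ_b) x_b)` is `-∞` or is attained at least twice. -/
def setTropicalization (Y : F1Scheme.{u, v}) (ν : SemiringValuation R TropicalReal)
    (X : (Y.baseChange R).ClosedSubscheme) : Set ((Y.baseChange TropicalReal).Points TropicalReal) :=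
  {p | ∃ (i : Y.Chart) (q : ScalarExt TropicalReal (Y.alg i) →ₐ[TropicalReal] TropicalReal),
    p = (Y.baseChange TropicalReal).point i q ∧
    ∀ f : ScalarExt R (Y.alg i), X.con i f 0 →
      MaxAttainedTwice fun b => q (ν.toFun (f.coeff b) • x b)}

end F1Scheme

namespace AlgebraicGeometry.Scheme

variable (X : Scheme.{u}) (𝒰 : Set X.affineOpens)

/-- The principal open subsets of the members of an affine open covering `𝒰`. -/
def PrincipalChart : Type u :=
  {V : X.Opens // ∃ U ∈ 𝒰, ∃ f : Γ(X, U.1), V = X.basicOpen f}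

variable {X 𝒰}

theorem PrincipalChart.isAffineOpen (V : X.PrincipalChart 𝒰) : IsAffineOpen V.1 := by
  obtain ⟨V, U, hU, f, rfl⟩ := V
  exact U.2.basicOpen f

/-- The order in which `V ≤ W` means that `V` is a principal open subset of `W`. -/
instance : Preorder (X.PrincipalChart 𝒰) where
  le V W := ∃ f : Γ(X, W.1), V.1 = X.basicOpen f
  le_refl V := ⟨1, by simp⟩
  le_trans := by
    rintro ⟨_, hV⟩ ⟨_, hW⟩ U ⟨g, h⟩ ⟨f, h'⟩
    dsimp only at g h h' 
    subst h'
    obtain ⟨f', hf'⟩ := U.isAffineOpen.basicOpen_basicOpen_is_basicOpen f g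
    exact ⟨f', h.trans hf'.symm⟩

theorem PrincipalChart.le_opens {V W : X.PrincipalChart 𝒰} (h : V ≤ W) : V.1 ≤ W.1 := by
  obtain ⟨f, hf⟩ := h
  rw [hf]; exact X.basicOpen_le f

theorem PrincipalChart.isPrincipalLoc {V W : X.PrincipalChart 𝒰} (h : V.1 ≤ W.1) {f : Γ(X, W.1)}
    (hf : V.1 = X.basicOpen f) :
    IsPrincipalLoc f ((X.presheaf.map (homOfLE h).op).hom) := by
  let := (X.presheaf.map (homOfLE h).op).hom.toAlgebra
  exact (isLocalization_iff_isLocalizationMap _ _).1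
    (W.isAffineOpen.isLocalization_of_eq_basicOpen f (homOfLE h) hf)

variable (X 𝒰)

/-- The scalar restriction `M(X)` of a scheme `X` to `𝔽₁`, formed with the affine open covering
`𝒰`: the coordinate rings of the members of `𝒰` and of their principal open subsets are replaced by
their multiplicative monoids, and these are glued as in `X`. -/
noncomputable abbrev scalarRestriction : F1Scheme.{u, u} where
  Chart := X.PrincipalChart 𝒰
  alg V := Γ(X, V.1)
  res h := ((X.presheaf.map (homOfLE (PrincipalChart.le_opens h)).op).hom).toMonoidWithZeroHom
  res_refl V a := by
    change (X.presheaf.map (𝟙 _)) a = a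
    simp
  res_trans h h' a := by
    change (X.presheaf.map _ ≫ X.presheaf.map _) a = (X.presheaf.map _) a
    rw [← X.presheaf.map_comp]
    rfl
  inter {V V' W} h h' := by
    obtain ⟨f, hf⟩ := id h
    obtain ⟨f', hf'⟩ := id h'
    obtain ⟨U, hU, g, hg⟩ := W.2
    let m : X.PrincipalChart 𝒰 := ⟨X.basicOpen (f * f'), by
      obtain ⟨W, hW⟩ := W
      dsimp only at hg f f'
      subst hg
      obtain ⟨g', hg'⟩ := U.2.basicOpen_basicOpen_is_basicOpen g (f * f')
      exact ⟨U, hU, g', hg'.symm⟩⟩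
    have hmV : m ≤ V := ⟨X.presheaf.map (homOfLE (PrincipalChart.le_opens h)).op f', by
      change X.basicOpen (f * f') = _
      rw [Scheme.basicOpen_mul, Scheme.basicOpen_res, hf]⟩
    have hmV' : m ≤ V' := ⟨X.presheaf.map (homOfLE (PrincipalChart.le_opens h')).op f, by
      change X.basicOpen (f * f') = _
      rw [Scheme.basicOpen_mul, Scheme.basicOpen_res, hf', inf_comm]⟩
    exact ⟨f, f', m, hmV, hmV', PrincipalChart.isPrincipalLoc _ hf,
      PrincipalChart.isPrincipalLoc _ hf', PrincipalChart.isPrincipalLoc _ rfl⟩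

instance [IsIntegral X] : (X.scalarRestriction 𝒰).IsLocallyIntegral where
  cancel V := by
    by_cases h : Nonempty V.1
    · have : IsDomain Γ(X, V.1) := inferInstance
      exact inferInstanceAs (IsCancelMulZero Γ(X, V.1))
    · have hV : V.1 = ⊥ := by
        ext y
        exact ⟨fun hy => (h ⟨⟨y, hy⟩⟩).elim, fun hy => hy.elim⟩
      have : Subsingleton Γ(X, V.1) := by rw [hV]; infer_instance
      refine @IsCancelMulZero.mk Γ(X, V.1) _ _ ?_ ?_
      exacts [⟨fun _ _ _ _ => Subsingleton.elim (α := Γ(X, V.1)) _ _⟩,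
        ⟨fun _ _ _ _ => Subsingleton.elim (α := Γ(X, V.1)) _ _⟩]

variable {X} {k : Type u} [Field k] (π : X ⟶ Spec (CommRingCat.of k))

/-- The scalars of a `k`-scheme as functions on an open subset. -/
noncomputable def scalars (U : X.Opens) : k →+* Γ(X, U) :=
  ((Scheme.ΓSpecIso (CommRingCat.of k)).inv ≫ π.appLE ⊤ U (by simp)).hom

theorem map_scalars {U V : X.Opens} (h : V ≤ U) (c : k) :
    X.presheaf.map (homOfLE h).op (scalars π U c) = scalars π V c := by
  have := π.appLE_map (U := ⊤) (V := U) (V' := V) (by simp) (homOfLE h).op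
  exact congrArg (fun θ => ((Scheme.ΓSpecIso (CommRingCat.of k)).inv ≫ θ) c) this

/-- The evaluation map `∑ λ_a x_a ↦ ∑ λ_a a` from `M(A) ⊗_{𝔽₁} k` to `A`, for the ring `A` of
functions on `U`. -/
noncomputable def ev (U : X.Opens) : ScalarExt k Γ(X, U) →+* Γ(X, U) :=
  letI : Algebra k Γ(X, U) := (scalars π U).toAlgebra
  (ScalarExt.lift (S := k) (MonoidWithZeroHom.id Γ(X, U))).toRingHom

theorem ev_x (U : X.Opens) (a : Γ(X, U)) : ev π U (ScalarExt.x a) = a := by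
  let : Algebra k Γ(X, U) := (scalars π U).toAlgebra
  exact ScalarExt.lift_x _ _

theorem ev_smul (U : X.Opens) (c : k) (f : ScalarExt k Γ(X, U)) :
    ev π U (c • f) = scalars π U c * ev π U f := by
  let : Algebra k Γ(X, U) := (scalars π U).toAlgebra
  exact (map_smul (ScalarExt.lift (S := k) (MonoidWithZeroHom.id Γ(X, U))) c f).trans
    (Algebra.smul_def _ _)

theorem ev_map {U V : X.Opens} (h : V ≤ U) (f : ScalarExt k Γ(X, U)) :
    ev π V (ScalarExt.map ((X.presheaf.map (homOfLE h).op).hom).toMonoidWithZeroHom f) =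
      X.presheaf.map (homOfLE h).op (ev π U f) := by
  induction f using ScalarExt.induction with
  | zero => simp
  | add f g hf hg => simp only [map_add, hf, hg]
  | single c a =>
    rw [map_smul, ScalarExt.map_x, ev_smul, ev_smul, ev_x, ev_x, map_mul, map_scalars]
    rfl

theorem ev_localize {V W : X.PrincipalChart 𝒰} (h : V ≤ W) (a b : ScalarExt k Γ(X, W.1)) :
    let φ := ((X.presheaf.map (homOfLE (PrincipalChart.le_opens h)).op).hom).toMonoidWithZeroHom
    ev π V.1 (ScalarExt.map φ a) = ev π V.1 (ScalarExt.map φ b) ↔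
      ∃ s, IsUnit (ScalarExt.map (S := k) φ s) ∧ ev π W.1 (s * a) = ev π W.1 (s * b) := by
  intro φ
  have hev : ∀ f, ev π V.1 (ScalarExt.map φ f) = φ (ev π W.1 f) :=
    ev_map π (PrincipalChart.le_opens h)
  constructor
  · intro hab
    obtain ⟨f, hf⟩ := id h
    have hloc : IsPrincipalLoc f φ := PrincipalChart.isPrincipalLoc (PrincipalChart.le_opens h) hf
    rw [hev, hev] at hab
    obtain ⟨⟨_, n, rfl⟩, hn⟩ := hloc.exists_of_eq hab
    refine ⟨ScalarExt.x (f ^ n), ?_, ?_⟩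
    · rw [ScalarExt.map_x]
      exact (hloc.map_units ⟨_, n, rfl⟩).map ScalarExt.x
    · rw [map_mul, map_mul, ev_x]; exact hn
  · rintro ⟨s, hs, hab⟩
    have hs' := hs.map (ev π V.1)
    have h2 := congrArg φ hab
    rw [← hev, ← hev, map_mul (ScalarExt.map φ), map_mul (ScalarExt.map φ), map_mul (ev π V.1),
      map_mul (ev π V.1)] at h2
    exact hs'.mul_left_cancel h2

/-- The universal embedding of `X` into `X̂ = M(X) ×_{𝔽₁} k`, as a closed subscheme of `X̂`: on
every patch it is given by the kernel of the evaluation map. -/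
noncomputable def universalEmbedding :
    ((X.scalarRestriction 𝒰).baseChange k).ClosedSubscheme where
  con V := (⊥ : RingCon Γ(X, V.1)).comap (ev π V.1)
  quasiCoherent h a b := ev_localize 𝒰 π h a b

/-- The universal tropicalization of an integral scheme `X` over `k`: the tropicalization with
respect to the universal embedding, as a scheme over the tropical semiring. -/
noncomputable abbrev universalTropicalization [IsIntegral X] (ν : SemiringValuation k TropicalReal) :
    SemiringScheme.{u, u, 0} TropicalReal :=
  ((X.scalarRestriction 𝒰).tropicalization ν (universalEmbedding 𝒰 π)).toScheme

/-- A point of the Berkovich analytification of a `k`-scheme `X`: a point of `X` together with a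
non-archimedean absolute value on its residue field that extends the absolute value `exp ∘ ν`
of `k`. -/
structure BerkovichPoint (ν : SemiringValuation k TropicalReal) where
  pt : X
  abv : AbsoluteValue (X.residueField pt) ℝ
  nonarchimedean : IsNonarchimedean abv
  extends_abs : ∀ c : k, abv (X.evaluation ⊤ pt trivial (scalars π ⊤ c)) = (ν.toFun c).exp

/-- The Berkovich topology: the coarsest one for which the map to `X` is continuous and
for which `|f|` is continuous for every function `f` on an open subset of `X`. -/
instance (ν : SemiringValuation k TropicalReal) : TopologicalSpace (BerkovichPoint π ν) :=
  TopologicalSpace.generateFrom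
    ({O | ∃ U : X.Opens, O = {z | z.pt ∈ U}} ∪
      {O | ∃ (U : X.Opens) (f : Γ(X, U)) (D : Set ℝ), IsOpen D ∧
        O = {z | ∃ hz : z.pt ∈ U, z.abv (X.evaluation U z.pt hz f) ∈ D}})

end AlgebraicGeometry.Scheme

/-! A tropical point of the patch of `V`, with `A = Γ(X, V)`, is a homomorphism `q` from `A ⊗ 𝕋` to
`𝕋`, which amounts to the multiplicative map `f ↦ q (x f)`. Since `q` sends a polynomial to the
maximum of its terms, respecting the bend relations of `f` means that this maximum is `-∞` or is
attained twice (`bend_trop_le_iff`); this gives the set-theoretic tropicalization. For the elements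
`x_{a+b} - x_a - x_b` and `c x_1 - x_c` of the kernel of evaluation, this condition says that `f ↦
exp q(x_f)` is ultrametric and extends the absolute value of `k` (`apply_x_add_le`,
`apply_x_scalar`). Conversely, these two properties imply the condition for the whole kernel
(`maxAttainedTwice_of_ultrametric`). So the tropical points of the patch are the multiplicative
ultrametric seminorms on `A` extending that of `k`. The kernel of such a seminorm is a prime, hence
a point of `V`, and the seminorm is an absolute value on its residue field: a point of the
analytification over `V`. Points of two patches are glued precisely when they give the same analytic
point, because charts that are principal in both patches cover their intersection
(`Corresponds.point_eq_iff`). For the topologies, tropical polynomials are continuous on the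
analytification, so closed subschemes have closed sets of points (`isClosed_image_points`).
Conversely, a closed set `C` is the set of points of the closed subscheme given by all equations
that hold on `C`, provided that every point outside `C` violates such an equation. This holds
because the sets given by an inequation are stable under finite intersections (`cross_ne_iff`) and
suffice to describe the subbasic open sets of the analytification (`isSeparating_of_isOpen`). -/

namespace TropicalReal

/-! ### The exponential, and inequations between tropical numbers. -/

theorem exp_zero : exp 0 = 0 := rfl

theorem exp_one : exp 1 = 1 := Real.exp_zero

theorem exp_mul (a b : TropicalReal) : exp (a * b) = exp a * exp b := by
  induction a using WithBot.recBotCoe with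
  | bot => exact (congrArg exp (zero_mul b)).trans (zero_mul (exp b)).symm
  | coe a =>
    induction b using WithBot.recBotCoe with
    | bot => exact (congrArg exp (mul_zero (M₀ := TropicalReal) _)).trans (mul_zero _).symm
    | coe b => exact Real.exp_add a b

theorem exp_nonneg (a : TropicalReal) : 0 ≤ exp a := by
  induction a using WithBot.recBotCoe with
  | bot => exact le_refl _
  | coe a => exact (Real.exp_pos a).le

theorem exp_strictMono : StrictMono exp := by
  intro a b h
  induction b using WithBot.recBotCoe with
  | bot => exact (not_lt_bot (α := WithBot ℝ) h).elim
  | coe b =>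
    induction a using WithBot.recBotCoe with
    | bot => exact Real.exp_pos b
    | coe a => exact Real.exp_lt_exp.2 (WithBot.coe_lt_coe.1 h)

theorem exp_injective : Function.Injective exp := exp_strictMono.injective

theorem exp_add (a b : TropicalReal) : exp (a + b) = max (exp a) (exp b) :=
  exp_strictMono.monotone.map_max

theorem exp_eq_zero {a : TropicalReal} : exp a = 0 ↔ a = 0 :=
  ⟨fun h => exp_injective h, fun h => by rw [h, exp_zero]⟩

theorem exists_exp_eq {r : ℝ} (hr : 0 ≤ r) : ∃ t, exp t = r := by
  rcases hr.eq_or_lt with rfl | h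
  · exact ⟨0, exp_zero⟩
  · exact ⟨(Real.log r : WithBot ℝ), Real.exp_log h⟩

theorem exp_pow (a : TropicalReal) (n : ℕ) : exp (a ^ n) = exp a ^ n := by
  induction n with
  | zero => simp [exp_one]
  | succ n ih => rw [pow_succ, pow_succ, exp_mul, ih]

theorem zero_le (a : TropicalReal) : 0 ≤ a := bot_le (α := WithBot ℝ)

theorem le_zero_iff {a : TropicalReal} : a ≤ 0 ↔ a = 0 := le_bot_iff (α := WithBot ℝ)

theorem isUnit_of_ne_zero {a : TropicalReal} (ha : a ≠ 0) : IsUnit a := by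
  obtain ⟨t, ht⟩ := exists_exp_eq (inv_nonneg.2 (exp_nonneg a))
  refine IsUnit.of_mul_eq_one t (exp_injective ?_)
  rw [exp_mul, ht, exp_one, mul_inv_cancel₀ (mt exp_eq_zero.1 ha)]

theorem le_add_left (a b : TropicalReal) : a ≤ a + b := le_max_left a b

theorem mul_le_mul_of_le {a b c : TropicalReal} (h : b ≤ c) : a * b ≤ a * c := by
  rw [← exp_strictMono.le_iff_le, exp_mul, exp_mul]
  exact mul_le_mul_of_nonneg_left (exp_strictMono.monotone h) (exp_nonneg a)

/-- Two inequations of tropical numbers hold simultaneously if and only if a single one does. -/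
theorem cross_ne_iff (a b c d : TropicalReal) :
    a * c + b * d ≠ a * d + b * c ↔ a ≠ b ∧ c ≠ d := by
  -- The product of the two larger factors strictly dominates both mixed products. The four possible
  -- orderings of the pairs all reduce to this one by symmetry.
  have key : ∀ {p q r s : ℝ}, 0 ≤ p → 0 ≤ q → p < r → q < s →
      max (p * q) (r * s) ≠ max (p * s) (r * q) := fun {p q r s} hp hq hr hs => by
    refine (lt_of_lt_of_le ?_ (le_max_right _ _)).ne'
    exact max_lt (mul_lt_mul_of_pos_right hr (hq.trans_lt hs))
      (mul_lt_mul_of_pos_left hs (hp.trans_lt hr))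
  constructor
  · refine fun h => ⟨?_, ?_⟩
    · rintro rfl; exact h (add_comm _ _)
    · rintro rfl; exact h rfl
  · rintro ⟨h, h'⟩ e
    have e' := congrArg exp e
    simp only [exp_add, exp_mul] at e'
    rcases lt_or_gt_of_ne h with h | h <;> rcases lt_or_gt_of_ne h' with h' | h' <;>
      have h := exp_strictMono h <;> have h' := exp_strictMono h'
    · exact key (exp_nonneg _) (exp_nonneg _) h h' e'
    · exact key (exp_nonneg _) (exp_nonneg _) h h' e'.symm
    · refine key (exp_nonneg _) (exp_nonneg _) h h' (.trans ?_ (e'.symm.trans ?_)) <;>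
        rw [max_comm]
    · refine key (exp_nonneg _) (exp_nonneg _) h h' (.trans ?_ (e'.trans ?_)) <;>
        rw [max_comm]

end TropicalReal

/-- In `𝕋` an identity `s + t = t` means `s ≤ t`, so `subadditive` is the ultrametric inequality. -/
theorem SemiringValuation.map_add_le {R : Type*} [CommRing R]
    (ν : SemiringValuation R TropicalReal) (a b : R) :
    ν.toFun (a + b) ≤ max (ν.toFun a) (ν.toFun b) := by
  have := ν.subadditive a b
  rw [add_assoc] at this
  exact (TropicalReal.le_add_left _ _).trans this.le

/-! ### Tropical points of a patch and the bend relations. -/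

namespace ScalarExt

open TropicalReal

section coeff

variable {S : Type*} [CommSemiring S] {B : Type*} [CommMonoidWithZero B]

theorem coeff_x {b : B} (hb : b ≠ 0) : (x b : ScalarExt S B).coeff = Finsupp.single b 1 := by
  ext c
  simp [x, proj, hb]

theorem coeff_smul_x_self (s : S) {b : B} (hb : b ≠ 0) : (s • x b : ScalarExt S B).coeff b = s := by
  simp [coeff_smul, coeff_x hb]

theorem coeff_smul_x_ne (s : S) {b c : B} (hbc : b ≠ c) : (s • x b : ScalarExt S B).coeff c = 0 := by
  by_cases hb : b = 0
  · subst hb; simp [zero_coeff]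
  · simp [coeff_smul, coeff_x hb, hbc]

/-- `coeff` as an additive homomorphism. -/
noncomputable def coeffHom : ScalarExt S B →+ (B →₀ S) where
  toFun := coeff
  map_zero' := zero_coeff
  map_add' := coeff_add

theorem eq_sum (f : ScalarExt S B) : f = ∑ b ∈ f.coeff.support, f.coeff b • x b := by
  ext c
  change _ = coeffHom _ c
  rw [map_sum, Finsupp.finsetSum_apply]
  change _ = ∑ b ∈ f.coeff.support, (f.coeff b • x b : ScalarExt S B).coeff c
  by_cases hc : c ∈ f.coeff.support
  · rw [Finset.sum_eq_single_of_mem c hc fun b _ hb => coeff_smul_x_ne _ hb, coeff_smul_x_self]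
    rintro rfl
    exact Finsupp.mem_support_iff.1 hc f.coeff_zero
  · rw [Finset.sum_eq_zero fun b hb => coeff_smul_x_ne (f.coeff b) (ne_of_mem_of_not_mem hb hc),
      Finsupp.notMem_support_iff.1 hc]

theorem erase_add (b : B) (f g : ScalarExt S B) : erase b (f + g) = erase b f + erase b g := by
  ext c; simp [erase, coeff_add, Finsupp.erase_add]

theorem erase_smul (b : B) (s : S) (f : ScalarExt S B) : erase b (s • f) = s • erase b f := by
  ext c
  by_cases hc : c = b
  · subst hc; simp [erase, coeff_smul]
  · simp [erase, coeff_smul, Finsupp.erase_ne hc]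

theorem erase_zero (b : B) : erase b (0 : ScalarExt S B) = 0 := by
  ext c; simp [erase, zero_coeff]

/-- Under a tropical point, this splits the value of `f` into the maximum of one term and of the
rest. -/
theorem coeff_smul_x_add_erase (b : B) (f : ScalarExt S B) :
    f.coeff b • x b + erase b f = f := by
  ext c
  rw [coeff_add, Finsupp.add_apply]
  by_cases hc : b = c
  · subst hc
    by_cases hb : b = 0
    · subst hb; simp [f.coeff_zero, erase, zero_coeff]
    · rw [coeff_smul_x_self _ hb]; simp [erase]
  · rw [coeff_smul_x_ne _ hc]; simp [erase, Finsupp.erase_ne (Ne.symm hc)]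

theorem mapCoeff_erase {R : Type*} [CommSemiring R] (ν : R → S) (h0 : ν 0 = 0) (b : B)
    (f : ScalarExt R B) : mapCoeff ν h0 (erase b f) = erase b (mapCoeff ν h0 f) := by
  ext c
  by_cases hc : c = b
  · subst hc; simp [erase, mapCoeff, h0]
  · simp [erase, mapCoeff, Finsupp.erase_ne hc]

end coeff

section tropicalPoints

variable {B : Type*} [CommMonoidWithZero B]
  (q : ScalarExt TropicalReal B →ₐ[TropicalReal] TropicalReal)

theorem apply_smul_x_le (f : ScalarExt TropicalReal B) (b : B) : q (f.coeff b • x b) ≤ q f := by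
  conv_rhs => rw [← coeff_smul_x_add_erase b f, map_add]
  exact le_add_left _ _

/-- Together with `apply_smul_x_le`, this says that `q f` is the maximum of the values of the terms
of `f`. The index may be `0`, whose term has the value `-∞`; this covers `f = 0`. -/
theorem exists_apply_eq (f : ScalarExt TropicalReal B) : ∃ b, q f = q (f.coeff b • x b) := by
  induction f using induction with
  | zero => exact ⟨0, by simp [zero_coeff]⟩
  | add f g hf hg =>
    -- A term that attains the larger of the two values also dominates the term of the other summand
    -- at the same monomial, so it survives in the sum.
    have key : ∀ {f g : ScalarExt TropicalReal B}, (∃ b, q f = q (f.coeff b • x b)) → q g ≤ q f →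
        ∃ b, q (f + g) = q ((f + g).coeff b • x b) := by
      rintro f g ⟨b, hb⟩ h
      refine ⟨b, ?_⟩
      rw [coeff_add, Finsupp.add_apply, add_smul, map_add, map_add, ← hb, add_def, add_def,
        max_eq_left h, max_eq_left ((apply_smul_x_le q g b).trans h)]
    rcases le_total (q f) (q g) with h | h
    · rw [add_comm]; exact key hg h
    · exact key hf h
  | single s b =>
    refine ⟨b, ?_⟩
    by_cases hb : b = 0
    · subst hb; simp
    · rw [coeff_smul_x_self _ hb]

/-- Deleting the term of `b` preserves the maximum precisely if the maximum is also attained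
elsewhere or is `-∞`. -/
theorem forall_apply_erase_iff (f : ScalarExt TropicalReal B) :
    (∀ b, q f = q (erase b f)) ↔ F1Scheme.MaxAttainedTwice fun b => q (f.coeff b • x b) := by
  constructor
  · intro h
    obtain ⟨b, hb⟩ := exists_apply_eq q f
    obtain ⟨c, hc⟩ := exists_apply_eq q (erase b f)
    rw [← h] at hc
    -- If the maximum of `erase b f` is found at the deleted monomial `b`, its coefficient there is
    -- `0`, so the whole maximum is `-∞`.
    by_cases hbc : c = b
    · subst hbc
      left
      intro d
      have h0 : q f = 0 := by rw [hc]; simp [erase]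
      exact TropicalReal.le_zero_iff.1 ((apply_smul_x_le q f d).trans h0.le)
    · right
      refine ⟨b, c, Ne.symm hbc, ?_, fun d => (apply_smul_x_le q f d).trans hb.le⟩
      change q _ = q _
      rw [← hb, hc]
      simp [erase, Finsupp.erase_ne hbc]
  · intro h b
    obtain ⟨d, hd⟩ := exists_apply_eq q f
    refine le_antisymm ?_ ?_
    · rcases h with h | ⟨b₁, b₂, hne, heq, hmax⟩
      · rw [hd]; exact (h d).le.trans (TropicalReal.zero_le _)
      · have key : ∀ c, c ≠ b → (∀ d, q (f.coeff d • x d) ≤ q (f.coeff c • x c)) →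
            q f ≤ q (erase b f) := fun c hc hm => by
          refine (hd.le.trans (hm d)).trans ?_
          have := apply_smul_x_le q (erase b f) c
          simpa [erase, Finsupp.erase_ne hc] using this
        by_cases h1 : b₁ = b
        · exact key b₂ (fun h2 => hne (h1.trans h2.symm)) fun d => (hmax d).trans heq.le
        · exact key b₁ h1 hmax
    · conv_rhs => rw [← coeff_smul_x_add_erase b f, map_add, add_comm]
      exact le_add_left _ _

variable {R : Type*} [CommRing R] (ν : SemiringValuation R TropicalReal)

/-- The congruence of `q` contains the generated one as soon as it contains the bend relations.
Since `erase b` and `q` are `𝕋`-linear, it suffices to check these on the valuations of elements of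
`I`, which span `trop ν I`. -/
theorem bend_trop_le_iff (I : Set (ScalarExt R B)) :
    (∀ f g, bend (trop ν I) f g → q f = q g) ↔
      ∀ f ∈ I, F1Scheme.MaxAttainedTwice fun b => q (ν.toFun (f.coeff b) • x b) := by
  constructor
  · intro h f hf
    refine (forall_apply_erase_iff q (mapCoeff ν.toFun ν.map_zero f)).1 fun b => ?_
    exact h _ _ (RingConGen.Rel.of _ _ ⟨_, Submodule.subset_span ⟨f, hf, rfl⟩, b, rfl, rfl⟩)
  · intro h
    have hle : bend (trop ν I) ≤ (⊥ : RingCon TropicalReal).comap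
        (q : ScalarExt TropicalReal B →+* TropicalReal) := by
      refine RingCon.ringConGen_le.2 ?_
      rintro f _ ⟨_, hf, b, rfl, rfl⟩
      change q f = q (erase b f)
      induction hf using Submodule.span_induction with
      | mem f hf =>
        obtain ⟨g, hg, rfl⟩ := hf
        exact (forall_apply_erase_iff q (mapCoeff ν.toFun ν.map_zero g)).2 (h g hg) b
      | zero => rw [erase_zero]
      | add f g _ _ hf hg => rw [erase_add, map_add, map_add, hf, hg]
      | smul s f _ hf => rw [erase_smul, map_smul, map_smul, hf]
    exact fun f g hfg => hle hfg

end tropicalPoints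

/-! ### Bend relations of the kernel of evaluation and ultrametric seminorms. -/

section evaluation

variable {k A : Type*} [Field k] [CommRing A] (ν : SemiringValuation k TropicalReal)
  (σ : k →+* A) (ε : ScalarExt k A →+* A)

/-- Otherwise `x_{a+b}` would be the only monomial at which the element `x_{a+b} - x_a - x_b` of the
kernel attains its maximum. -/
theorem apply_x_add_le (hx : ∀ a, ε (x a) = a)
    (hs : ∀ c f, ε (c • f) = σ c * ε f)
    (q : ScalarExt TropicalReal A →ₐ[TropicalReal] TropicalReal)
    (hq : ∀ f, ε f = 0 → F1Scheme.MaxAttainedTwice fun b => q (ν.toFun (f.coeff b) • x b))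
    (a b : A) : q (x (a + b)) ≤ max (q (x a)) (q (x b)) := by
  by_contra! hlt
  obtain ⟨ha, hb⟩ := max_lt_iff.1 hlt
  have hab : a + b ≠ 0 := fun h => by
    rw [h, map_zero, map_zero] at ha
    exact ha.not_ge (TropicalReal.zero_le _)
  have hna : a ≠ a + b := fun h => ha.ne (congrArg (fun c => q (x c)) h)
  have hnb : b ≠ a + b := fun h => hb.ne (congrArg (fun c => q (x c)) h)
  let f : ScalarExt k A := (1 : k) • x (a + b) + ((-1 : k) • x a + (-1 : k) • x b)
  have hf : ε f = 0 := by
    simp only [f, map_add, hs, hx, map_one, map_neg]; ring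
  have hν1 : ν.toFun (-1) = 1 := by rw [ν.map_neg, ν.map_one]
  -- Only upper bounds on the coefficients are used: `a` and `b` may coincide, which gives the
  -- coefficient `-2`, or one of them may be `0`, which gives no term. Here `1` is the real number
  -- zero.
  have hcoeff : ∀ c d : A, ν.toFun (((-1 : k) • x c : ScalarExt k A).coeff d) ≤ 1 ∧
      (c ≠ d → ((-1 : k) • x c : ScalarExt k A).coeff d = 0) := fun c d => by
    refine ⟨?_, fun h => coeff_smul_x_ne _ h⟩
    by_cases hcd : c = d
    · subst hcd
      by_cases hc : c = 0
      · subst hc; simp [zero_coeff, ν.map_zero, TropicalReal.zero_le]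
      · rw [coeff_smul_x_self _ hc, hν1]
    · rw [coeff_smul_x_ne _ hcd, ν.map_zero]; exact TropicalReal.zero_le _
  have hself : q (ν.toFun (f.coeff (a + b)) • x (a + b)) = q (x (a + b)) := by
    have : f.coeff (a + b) = 1 := by
      simp only [f, coeff_add, Finsupp.add_apply]
      rw [coeff_smul_x_self _ hab, coeff_smul_x_ne _ hna, coeff_smul_x_ne _ hnb]; simp
    rw [this, ν.map_one, one_smul]
  have hother : ∀ d, d ≠ a + b → q (ν.toFun (f.coeff d) • x d) < q (x (a + b)) := fun d hd => by
    have e : f.coeff d = ((-1 : k) • x a : ScalarExt k A).coeff d +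
        ((-1 : k) • x b : ScalarExt k A).coeff d := by
      simp only [f, coeff_add, Finsupp.add_apply]
      rw [coeff_smul_x_ne _ (Ne.symm hd), zero_add]
    have hle : q (ν.toFun (f.coeff d) • x d) ≤ q (x d) := by
      rw [map_smul, smul_eq_mul, mul_comm]
      refine (TropicalReal.mul_le_mul_of_le (c := 1) ?_).trans (mul_one _).le
      rw [e]
      exact (ν.map_add_le _ _).trans (max_le (hcoeff a d).1 (hcoeff b d).1)
    by_cases hda : a = d
    · subst hda; exact hle.trans_lt ha
    by_cases hdb : b = d
    · subst hdb; exact hle.trans_lt hb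
    rw [e, (hcoeff a d).2 hda, (hcoeff b d).2 hdb, add_zero, ν.map_zero, zero_smul, map_zero]
    exact (TropicalReal.zero_le _).trans_lt ha
  rcases hq f hf with h | ⟨d, d', hne, heq, hmax⟩
  · have h0 := h (a + b)
    simp only [hself] at h0
    rw [h0] at ha
    exact ha.not_ge (TropicalReal.zero_le _)
  · have h1 := hmax (a + b)
    simp only [hself] at h1 heq
    by_cases hd : d = a + b
    · rw [heq] at h1
      exact (hother d' fun h => hne (hd.trans h.symm)).not_ge h1
    · exact (hother d hd).not_ge h1

/-- The element `c x_1 - x_{σ c}` of the kernel has only two terms, so their values must agree. -/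
theorem apply_x_scalar (hx : ∀ a, ε (x a) = a)
    (hs : ∀ c f, ε (c • f) = σ c * ε f)
    (q : ScalarExt TropicalReal A →ₐ[TropicalReal] TropicalReal)
    (hq : ∀ f, ε f = 0 → F1Scheme.MaxAttainedTwice fun b => q (ν.toFun (f.coeff b) • x b))
    (c : k) : q (x (σ c)) = ν.toFun c := by
  -- The zero ring has no tropical points; hence `σ` is injective.
  have : Nontrivial A := by
    by_contra! hA
    have h01 : (1 : TropicalReal) = 0 := by
      rw [← map_one q, ← map_one x, Subsingleton.elim (1 : A) 0, map_zero, map_zero]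
    exact one_ne_zero h01
  -- The cases `0` and `1` are separate because there the second monomial vanishes or coincides with
  -- `x_1`.
  by_cases hc0 : c = 0
  · subst hc0; rw [map_zero, map_zero, map_zero, ν.map_zero]
  by_cases hc1 : c = 1
  · subst hc1; rw [map_one, map_one, map_one, ν.map_one]
  have h0 : σ c ≠ 0 := fun h => hc0 (σ.injective (h.trans (map_zero σ).symm))
  have h1 : σ c ≠ 1 := fun h => hc1 (σ.injective (h.trans (map_one σ).symm))
  let f : ScalarExt k A := c • x 1 + (-1 : k) • x (σ c)
  have hf : ε f = 0 := by
    simp only [f, map_add, hs, hx, map_one, map_neg]; ring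
  have t1 : q (ν.toFun (f.coeff 1) • x 1) = ν.toFun c := by
    simp only [f, coeff_add, Finsupp.add_apply]
    rw [coeff_smul_x_self _ one_ne_zero, coeff_smul_x_ne _ h1, add_zero, map_one, map_smul,
      map_one, smul_eq_mul, mul_one]
  have t2 : q (ν.toFun (f.coeff (σ c)) • x (σ c)) = q (x (σ c)) := by
    simp only [f, coeff_add, Finsupp.add_apply]
    rw [coeff_smul_x_self _ h0, coeff_smul_x_ne _ (Ne.symm h1), zero_add, ν.map_neg, ν.map_one,
      one_smul]
  have t3 : ∀ d, d ≠ 1 → d ≠ σ c → q (ν.toFun (f.coeff d) • x d) = 0 := fun d hd hd' => by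
    simp only [f, coeff_add, Finsupp.add_apply]
    rw [coeff_smul_x_ne _ (Ne.symm hd), coeff_smul_x_ne _ (Ne.symm hd'), add_zero, ν.map_zero,
      zero_smul, map_zero]
  rcases hq f hf with h | ⟨d, d', hne, heq, hmax⟩
  · rw [← t1, ← t2]; exact (h _).trans (h _).symm
  · have zero : q (ν.toFun (f.coeff d) • x d) = 0 → q (x (σ c)) = ν.toFun c := fun hd => by
      have g1 := hmax 1
      have g2 := hmax (σ c)
      simp only [t1, t2, hd, TropicalReal.le_zero_iff] at g1 g2
      rw [g1, g2]
    by_cases hd1 : d = 1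
    · by_cases hd2 : d' = σ c
      · subst hd1 hd2; rw [← t1, ← t2]; exact heq.symm
      · exact zero (heq.trans (t3 d' (fun h => hne (hd1.trans h.symm)) hd2))
    · by_cases hd2 : d = σ c
      · by_cases hd3 : d' = 1
        · subst hd2 hd3; rw [← t1, ← t2]; exact heq
        · exact zero (heq.trans (t3 d' hd3 fun h => hne (hd2.trans h.symm)))
      · exact zero (t3 d hd1 hd2)

/-- For `f` in the kernel, each `σ(λ_b) b` is minus the sum of the other ones. By the ultrametric
inequality the term of `b` is bounded by the maximum of the other terms, so deleting it changes
nothing. -/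
theorem maxAttainedTwice_of_ultrametric (hx : ∀ a, ε (x a) = a)
    (hs : ∀ c f, ε (c • f) = σ c * ε f)
    (q : ScalarExt TropicalReal A →ₐ[TropicalReal] TropicalReal)
    (hadd : ∀ a b : A, q (x (a + b)) ≤ max (q (x a)) (q (x b)))
    (hsc : ∀ c, q (x (σ c)) = ν.toFun c) (f : ScalarExt k A) (hf : ε f = 0) :
    F1Scheme.MaxAttainedTwice fun b => q (ν.toFun (f.coeff b) • x b) := by
  have hterm : ∀ (c : k) (b : A), q (ν.toFun c • x b) = q (x (σ c * b)) := fun c b => by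
    rw [map_smul, smul_eq_mul, ← hsc, ← map_mul, ← map_mul]
  have hneg : ∀ a, q (x (-a)) = q (x a) := fun a => by
    rw [neg_eq_neg_one_mul, ← map_one σ, ← map_neg, map_mul, map_mul, hsc, ν.map_neg, ν.map_one,
      one_mul]
  have hsum : ∀ (s : Finset A) (g : A → A) (t : TropicalReal), (∀ i ∈ s, q (x (g i)) ≤ t) →
      q (x (∑ i ∈ s, g i)) ≤ t := by
    classical
    intro s g t ht
    induction s using Finset.induction_on with
    | empty => rw [Finset.sum_empty, map_zero, map_zero]; exact TropicalReal.zero_le t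
    | insert i s hi ih =>
      rw [Finset.sum_insert hi]
      exact (hadd _ _).trans (max_le (ht i (by simp)) (ih fun j hj => ht j (by simp [hj])))
  have hev : ∀ h : ScalarExt k A, q (x (ε h)) ≤ q (mapCoeff ν.toFun ν.map_zero h) := fun h => by
    conv_lhs => rw [eq_sum h, map_sum]
    refine hsum _ _ _ fun b _ => ?_
    rw [hs, hx, ← hterm]
    exact apply_smul_x_le q (mapCoeff ν.toFun ν.map_zero h) b
  refine (forall_apply_erase_iff q (mapCoeff ν.toFun ν.map_zero f)).1 fun b => ?_
  conv_lhs => rw [← coeff_smul_x_add_erase b (mapCoeff ν.toFun ν.map_zero f), map_add]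
  refine max_eq_right (α := TropicalReal) ?_
  change q (ν.toFun (f.coeff b) • x b) ≤ _
  have h0 : σ (f.coeff b) * b = -ε (erase b f) := by
    rw [← coeff_smul_x_add_erase b f, map_add, hs, hx] at hf
    exact eq_neg_of_add_eq_zero_left hf
  rw [hterm, h0, hneg, ← mapCoeff_erase]
  exact hev _

end evaluation

end ScalarExt

/-! ### Points of glued semiring schemes and of their closed subschemes. -/

namespace SemiringScheme

section points

variable {S : Type w} [CommSemiring S] {Y : SemiringScheme.{u, v, w} S}
  {T : Type*} [CommSemiring T] [Algebra S T]

theorem exists_comp_res_eq {i j : Y.Chart} (h : i ≤ j) {f : Y.alg j}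
    (hf : IsPrincipalLoc f (Y.res h)) (φ : Y.alg j →ₐ[S] T) (hφ : IsUnit (φ f)) :
    ∃ χ : Y.alg i →ₐ[S] T, χ.comp (Y.res h) = φ := by
  let := (Y.res h : Y.alg j →+* Y.alg i).toAlgebra
  have : IsLocalization (Submonoid.powers f) (Y.alg i) :=
    (isLocalization_iff_isLocalizationMap _ _).2 hf
  have hg : ∀ y : Submonoid.powers f, IsUnit ((φ : Y.alg j →+* T) y) := by
    rintro ⟨_, n, rfl⟩
    simpa using hφ.pow n
  have hlift : ∀ a, IsLocalization.lift (S := Y.alg i) hg (Y.res h a) = φ a :=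
    fun a => IsLocalization.lift_eq hg a
  refine ⟨{ IsLocalization.lift (S := Y.alg i) hg with commutes' := fun s => ?_ }, ?_⟩
  · change IsLocalization.lift (S := Y.alg i) hg _ = _
    rw [← (Y.res h).commutes s, hlift, φ.commutes]
  · ext a; exact hlift a

theorem exists_unit_mul_eq_res {i j : Y.Chart} (h : i ≤ j) (a : Y.alg i) :
    ∃ s b, IsUnit (Y.res h s) ∧ Y.res h s * a = Y.res h b := by
  obtain ⟨f, hf⟩ := Y.exists_principalLoc h
  obtain ⟨⟨b, s⟩, hs⟩ := hf.surj a
  exact ⟨s, b, hf.map_units s, by rw [mul_comm]; exact hs⟩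

theorem comp_res_injective {i j : Y.Chart} (h : i ≤ j) :
    Function.Injective fun χ : Y.alg i →ₐ[S] T => χ.comp (Y.res h) := by
  intro χ χ' hχ
  ext a
  obtain ⟨s, b, hs, hb⟩ := exists_unit_mul_eq_res h a
  have key : ∀ b, χ (Y.res h b) = χ' (Y.res h b) := fun b => congrArg (fun θ => θ b) hχ
  refine (hs.map χ).mul_left_cancel ?_
  rw [← map_mul, hb, key, key, ← hb, map_mul]

theorem comp_res_comp_res {i j l : Y.Chart} (h : i ≤ j) (h' : j ≤ l) (χ : Y.alg i →ₐ[S] T) :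
    (χ.comp (Y.res h)).comp (Y.res h') = χ.comp (Y.res (h.trans h')) := by
  ext a; exact congrArg χ (Y.res_trans h h' a)

/-- For transitivity, the patches that relate `q` to `p` and to `r` both lie below the patch of `q`
and meet in a patch `m`, the localization at `b * b'`. The point `q` factors through both, so it
sends `b` and `b'` to units and factors through `m`. Hence equality of points needs no chains of
identifications. -/
theorem pointRel_equivalence (T : Type*) [CommSemiring T] [Algebra S T] :
    Equivalence (Y.PointRel T) where
  refl p := ⟨p.1, le_rfl, le_rfl, p.2, by ext a; simp [Y.res_refl], by ext a; simp [Y.res_refl]⟩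
  symm := fun ⟨l, h, h', χ, hp, hq⟩ => ⟨l, h', h, χ, hq, hp⟩
  trans := by
    rintro p q r ⟨l, hlp, hlq, χ, hχp, hχq⟩ ⟨l', hlq', hlr', χ', hχq', hχr'⟩
    obtain ⟨b, b', m, hm, hm', hb, hb', hbb'⟩ := Y.inter hlq hlq'
    have u : IsUnit (q.2 b) := by
      rw [← hχq]; exact (hb.map_units ⟨_, 1, by simp⟩).map χ
    have u' : IsUnit (q.2 b') := by
      rw [← hχq']; exact (hb'.map_units ⟨_, 1, by simp⟩).map χ'
    obtain ⟨θ, hθ⟩ := exists_comp_res_eq (hm.trans hlq) hbb' q.2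
      (by rw [map_mul]; exact u.mul u')
    have e : θ.comp (Y.res hm) = χ := comp_res_injective hlq (by
      change (θ.comp (Y.res hm)).comp (Y.res hlq) = χ.comp (Y.res hlq)
      rw [comp_res_comp_res, hθ, hχq])
    have e' : θ.comp (Y.res hm') = χ' := comp_res_injective hlq' (by
      change (θ.comp (Y.res hm')).comp (Y.res hlq') = χ'.comp (Y.res hlq')
      rw [comp_res_comp_res, hθ, hχq'])
    refine ⟨m, hm.trans hlp, hm'.trans hlr', θ, ?_, ?_⟩
    · rw [← comp_res_comp_res hm hlp, e, hχp]
    · rw [← comp_res_comp_res hm' hlr', e', hχr']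

namespace ClosedSubscheme

variable (Z : Y.ClosedSubscheme)

/-- By quasi-coherence, a relation on the smaller patch comes from one on the larger patch after
clearing denominators, and these are units under `χ`. -/
theorem comp_res_respects_iff {i j : Y.Chart} (h : i ≤ j) (χ : Y.alg i →ₐ[S] T) :
    (∀ a b, Z.con j a b → χ.comp (Y.res h) a = χ.comp (Y.res h) b) ↔
      ∀ a b, Z.con i a b → χ a = χ b := by
  refine ⟨fun H a b hab => ?_, fun H a b hab => H _ _ (Z.con_res h hab)⟩
  obtain ⟨s, a', hs, ha⟩ := exists_unit_mul_eq_res h a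
  obtain ⟨t, b', ht, hb⟩ := exists_unit_mul_eq_res h b
  have hab' : Z.con i (Y.res h (t * a')) (Y.res h (s * b')) := by
    have e1 : Y.res h (t * a') = Y.res h (s * t) * a := by
      rw [map_mul, map_mul, ← ha]; ring
    have e2 : Y.res h (s * b') = Y.res h (s * t) * b := by
      rw [map_mul, map_mul, ← hb]; ring
    rw [e1, e2]
    exact (Z.con i).mul ((Z.con i).refl _) hab
  obtain ⟨r, hr, hr'⟩ := (Z.quasiCoherent h _ _).1 hab'
  have e := H _ _ hr'
  change χ (Y.res h _) = χ (Y.res h _) at e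
  simp only [map_mul, ← ha, ← hb] at e
  refine (((hr.mul hs).mul ht).map χ).mul_left_cancel ?_
  simp only [map_mul]
  calc _ = _ := by ring
    _ = _ := e
    _ = _ := by ring

/-- Extend a homomorphism that respects the congruence to the quotient. -/
noncomputable def liftHom {i : Y.Chart} (φ : Y.alg i →ₐ[S] T)
    (h : ∀ a b, Z.con i a b → φ a = φ b) : (Z.con i).Quotient →ₐ[S] T where
  toRingHom := (Z.con i).lift (φ : Y.alg i →+* T) h
  commutes' s := φ.commutes s

theorem quotMap_surjective (i : Y.Chart) : Function.Surjective (Z.quotMap i) :=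
  (Z.con i).mk'_surjective

theorem quotMap_eq {i : Y.Chart} {a b : Y.alg i} (h : Z.con i a b) :
    Z.quotMap i a = Z.quotMap i b := (Z.con i).eq.2 h

theorem comp_quotMap_respects {i : Y.Chart} (φ : (Z.con i).Quotient →ₐ[S] T) (a b : Y.alg i)
    (h : Z.con i a b) : φ.comp (Z.quotMap i) a = φ.comp (Z.quotMap i) b :=
  congrArg φ (Z.quotMap_eq h)

theorem comp_quotMap_injective (i : Y.Chart) :
    Function.Injective fun φ : (Z.con i).Quotient →ₐ[S] T => φ.comp (Z.quotMap i) := by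
  intro φ ψ h
  refine AlgHom.ext fun a => ?_
  obtain ⟨a, rfl⟩ := Z.quotMap_surjective i a
  exact congrArg (fun θ => θ a) h

end ClosedSubscheme

variable [IsLocalRing T]

theorem point_eq_point_iff {i j : Y.Chart} {φ : Y.alg i →ₐ[S] T} {ψ : Y.alg j →ₐ[S] T} :
    Y.point i φ = Y.point j ψ ↔ Y.PointRel T ⟨i, φ⟩ ⟨j, ψ⟩ :=
  ⟨fun h => (pointRel_equivalence T).eqvGen_iff.1 (Quot.eqvGen_exact h), fun h => Quot.sound h⟩

theorem point_comp_res {i j : Y.Chart} (h : i ≤ j) (χ : Y.alg i →ₐ[S] T) :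
    Y.point j (χ.comp (Y.res h)) = Y.point i χ :=
  point_eq_point_iff.2 ⟨i, h, le_rfl, χ, rfl, by ext a; simp [Y.res_refl]⟩

theorem exists_point_eq (p : Y.Points T) : ∃ i φ, p = Y.point i φ := by
  induction p using Quot.inductionOn with | _ p => exact ⟨p.1, p.2, rfl⟩

namespace ClosedSubscheme

variable (Z : Y.ClosedSubscheme)

theorem incl_point (i : Y.Chart) (φ : (Z.con i).Quotient →ₐ[S] T) :
    Z.incl T (Z.toScheme.point i φ) = Y.point i (φ.comp (Z.quotMap i)) := rfl

/-- An identification in `Y` is realized by a point of a patch below both; by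
`comp_res_respects_iff` that point again respects the congruence, so it lifts to `Z`. -/
theorem incl_injective : Function.Injective (Z.incl T) := by
  intro p q hpq
  obtain ⟨i, φ, rfl⟩ := exists_point_eq p
  obtain ⟨j, ψ, rfl⟩ := exists_point_eq q
  rw [incl_point, incl_point, point_eq_point_iff] at hpq
  obtain ⟨l, h, h', χ, hφ, hψ⟩ := hpq
  dsimp only at h h' hφ hψ
  have hχ := (Z.comp_res_respects_iff h χ).1 (by rw [hφ]; exact Z.comp_quotMap_respects φ)
  refine point_eq_point_iff.2 ⟨l, h, h', Z.liftHom χ hχ, ?_, ?_⟩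
  · exact Z.comp_quotMap_injective i hφ
  · exact Z.comp_quotMap_injective j hψ

/-- Respecting the congruence does not depend on the representative, so membership can be tested on
any patch that contains the point. -/
theorem point_mem_points_iff {i : Y.Chart} {φ : Y.alg i →ₐ[S] T} :
    Y.point i φ ∈ Z.points T ↔ ∀ a b, Z.con i a b → φ a = φ b := by
  constructor
  · rintro ⟨p, hp⟩
    obtain ⟨j, ψ, rfl⟩ := exists_point_eq p
    rw [incl_point, point_eq_point_iff] at hp
    obtain ⟨l, h, h', χ, hψ, hφ⟩ := hp
    dsimp only at h h' hφ hψ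
    rw [← hφ, Z.comp_res_respects_iff h', ← Z.comp_res_respects_iff h, hψ]
    exact Z.comp_quotMap_respects ψ
  · intro h
    exact ⟨Z.toScheme.point i (Z.liftHom φ h), rfl⟩

end ClosedSubscheme

/-- The closed subscheme cut out by all equations that hold at a set `C` of points with values in
a semifield-like semiring, in which all nonzero elements are units. -/
def vanishing (hT : ∀ t : T, t ≠ 0 → IsUnit t) (C : Set (Y.Points T)) : Y.ClosedSubscheme where
  con i :=
    { r := fun a b => ∀ φ : Y.alg i →ₐ[S] T, Y.point i φ ∈ C → φ a = φ b
      iseqv := ⟨fun _ _ _ => rfl, fun h φ hφ => (h φ hφ).symm,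
        fun h h' φ hφ => (h φ hφ).trans (h' φ hφ)⟩
      add' := fun h h' φ hφ => by rw [map_add, map_add, h φ hφ, h' φ hφ]
      mul' := fun h h' φ hφ => by rw [map_mul, map_mul, h φ hφ, h' φ hφ] }
  quasiCoherent {i j} h a b := by
    constructor
    · intro hab
      obtain ⟨f, hf⟩ := Y.exists_principalLoc h
      refine ⟨f, hf.map_units ⟨_, 1, by simp⟩, fun φ hφ => ?_⟩
      rw [map_mul, map_mul]
      -- Multiplication by the localizing element `f` makes both sides vanish at points outside the
      -- smaller patch; at the other points `f` is a unit and the equation on the smaller patch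
      -- applies.
      by_cases h0 : φ f = 0
      · rw [h0, zero_mul, zero_mul]
      · obtain ⟨χ, rfl⟩ := exists_comp_res_eq h hf φ (hT _ h0)
        exact congrArg (_ * ·) (hab χ (by rwa [point_comp_res] at hφ))
    · rintro ⟨s, hs, hab⟩ χ hχ
      have := hab (χ.comp (Y.res h)) (by rwa [point_comp_res])
      rw [map_mul, map_mul] at this
      exact (hs.map χ).mul_left_cancel this

theorem subset_points_vanishing (hT : ∀ t : T, t ≠ 0 → IsUnit t) (C : Set (Y.Points T)) :
    C ⊆ (vanishing hT C).points T := by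
  intro p hp
  obtain ⟨i, φ, rfl⟩ := exists_point_eq p
  exact (vanishing hT C).point_mem_points_iff.2 fun a b hab => hab φ hp

theorem points_vanishing_subset (hT : ∀ t : T, t ≠ 0 → IsUnit t) {C : Set (Y.Points T)}
    (hC : ∀ i (φ : Y.alg i →ₐ[S] T), Y.point i φ ∉ C →
      ∃ a b, φ a ≠ φ b ∧ ∀ ψ : Y.alg i →ₐ[S] T, Y.point i ψ ∈ C → ψ a = ψ b) :
    (vanishing hT C).points T ⊆ C := by
  intro p hp
  obtain ⟨i, φ, rfl⟩ := exists_point_eq p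
  by_contra hn
  obtain ⟨a, b, hne, hab⟩ := hC i φ hn
  exact hne ((vanishing hT C).point_mem_points_iff.1 hp a b hab)

end points

/-! ### Sets of tropical points given by inequations. -/

section topology

/-- A set of tropical points of an algebra that is the union of sets given by an inequation. -/
def IsSeparating {D : Type*} [CommSemiring D] [Algebra TropicalReal D]
    (O : Set (D →ₐ[TropicalReal] TropicalReal)) : Prop :=
  ∀ φ ∈ O, ∃ a b, φ a ≠ φ b ∧ ∀ ψ : D →ₐ[TropicalReal] TropicalReal, ψ a ≠ ψ b → ψ ∈ O

variable {D : Type*} [CommSemiring D] [Algebra TropicalReal D]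

theorem isSeparating_univ : IsSeparating (Set.univ : Set (D →ₐ[TropicalReal] TropicalReal)) :=
  fun φ _ => ⟨1, 0, by simp, fun _ _ => trivial⟩

theorem isSeparating_ne (a b : D) :
    IsSeparating {φ : D →ₐ[TropicalReal] TropicalReal | φ a ≠ φ b} :=
  fun _ hφ => ⟨a, b, hφ, fun _ hψ => hψ⟩

theorem IsSeparating.inter {O O' : Set (D →ₐ[TropicalReal] TropicalReal)} (h : IsSeparating O)
    (h' : IsSeparating O') : IsSeparating (O ∩ O') := by
  rintro φ ⟨hφ, hφ'⟩
  obtain ⟨a, b, hab, H⟩ := h φ hφ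
  obtain ⟨c, d, hcd, H'⟩ := h' φ hφ'
  -- The positive and the negative part of `(a - b)(c - d)`, compared as two sides of an equation.
  refine ⟨a * c + b * d, a * d + b * c, ?_, fun ψ hψ => ?_⟩
  · simp only [map_add, map_mul]
    exact (TropicalReal.cross_ne_iff _ _ _ _).2 ⟨hab, hcd⟩
  · simp only [map_add, map_mul] at hψ
    obtain ⟨h1, h2⟩ := (TropicalReal.cross_ne_iff _ _ _ _).1 hψ
    exact ⟨H ψ h1, H' ψ h2⟩

/-- A strict inequality `a < b` is the inequation `max a b ≠ a`. -/
theorem isSeparating_lt (a b : D) :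
    IsSeparating {φ : D →ₐ[TropicalReal] TropicalReal | φ a < φ b} := by
  have : {φ : D →ₐ[TropicalReal] TropicalReal | φ a < φ b} = {φ | φ (a + b) ≠ φ a} := by
    ext φ
    change _ ↔ φ (a + b) ≠ φ a
    rw [map_add, TropicalReal.add_def, Ne, max_eq_left_iff, not_le]
    rfl
  rw [this]
  exact isSeparating_ne _ _

theorem IsSeparating.of_local {O : Set (D →ₐ[TropicalReal] TropicalReal)}
    (h : ∀ φ ∈ O, ∃ O', IsSeparating O' ∧ φ ∈ O' ∧ O' ⊆ O) : IsSeparating O := by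
  intro φ hφ
  obtain ⟨O', hO', hφ', hsub⟩ := h φ hφ
  obtain ⟨a, b, hab, H⟩ := hO' φ hφ'
  exact ⟨a, b, hab, fun ψ hψ => hsub (H ψ hψ)⟩

end topology

end SemiringScheme

/-! ### From seminorms on a ring to absolute values on a field. -/

section absoluteValue

variable {A K : Type*} [CommRing A] [Field K] {ρ : A →+* K} {N : A → ℝ}

/-- Adding an element of seminorm `0` cannot increase an ultrametric seminorm, so `N` is constant on
the cosets of its kernel. -/
theorem eq_of_map_eq_of_ultrametric (hadd : ∀ a b, N (a + b) ≤ max (N a) (N b))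
    (hnn : ∀ a, 0 ≤ N a) (hker : ∀ a, N a = 0 ↔ ρ a = 0) {a b : A} (h : ρ a = ρ b) :
    N a = N b := by
  have key : ∀ a b, ρ a = ρ b → N a ≤ N b := fun a b h => by
    have h0 : N (a - b) = 0 := (hker _).2 (by rw [map_sub, h, sub_self])
    have := hadd (a - b) b
    rwa [sub_add_cancel, h0, max_eq_right (hnn b)] at this
  exact le_antisymm (key a b h) (key b a h.symm)

/-- A multiplicative non-archimedean seminorm on a ring extends to a field of fractions of the
quotient by its kernel. -/
theorem exists_absoluteValue_of_ultrametric (hρ : ∀ c, ∃ a b, ρ b ≠ 0 ∧ c * ρ b = ρ a)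
    (hone : N 1 = 1) (hmul : ∀ a b, N (a * b) = N a * N b)
    (hadd : ∀ a b, N (a + b) ≤ max (N a) (N b)) (hnn : ∀ a, 0 ≤ N a)
    (hker : ∀ a, N a = 0 ↔ ρ a = 0) :
    ∃ v : AbsoluteValue K ℝ, IsNonarchimedean v ∧ ∀ a, v (ρ a) = N a := by
  choose num den hden hnum using hρ
  have hN : ∀ {b}, ρ b ≠ 0 → N b ≠ 0 := fun hb h => hb ((hker _).1 h)
  let v : K → ℝ := fun c => N (num c) / N (den c)
  -- The quotient does not depend on the chosen fraction: after cross-multiplication, both sides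
  -- have the same image under `ρ`.
  have key : ∀ c a b, ρ b ≠ 0 → c * ρ b = ρ a → v c = N a / N b := fun c a b hb h => by
    rw [div_eq_div_iff (hN (hden c)) (hN hb), ← hmul, ← hmul]
    refine eq_of_map_eq_of_ultrametric hadd hnn hker ?_
    rw [map_mul, map_mul, ← hnum, ← h]; ring
  have hv : ∀ a, v (ρ a) = N a := fun a => by
    rw [key (ρ a) a 1 (by simp) (by simp), hone, div_one]
  have hvmul : ∀ c d, v (c * d) = v c * v d := fun c d => by
    rw [key (c * d) (num c * num d) (den c * den d)
      (by rw [map_mul]; exact mul_ne_zero (hden c) (hden d))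
      (by rw [map_mul, map_mul, ← hnum, ← hnum]; ring), hmul, hmul, mul_div_mul_comm]
  have hvnn : ∀ c, 0 ≤ v c := fun c => div_nonneg (hnn _) (hnn _)
  have hvadd : ∀ c d, v (c + d) ≤ max (v c) (v d) := fun c d => by
    have hcd : ρ (den c * den d) ≠ 0 := by rw [map_mul]; exact mul_ne_zero (hden c) (hden d)
    -- Over a common denominator, the inequality becomes the one for the numerators.
    rw [key (c + d) (num c * den d + num d * den c) (den c * den d) hcd
        (by simp only [map_mul, map_add, ← hnum]; ring),
      key c (num c * den d) (den c * den d) hcd (by simp only [map_mul, ← hnum]; ring),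
      key d (num d * den c) (den c * den d) hcd (by simp only [map_mul, ← hnum]; ring),
      max_div_div_right (hnn _)]
    exact div_le_div_of_nonneg_right (hadd _ _) (hnn _)
  refine ⟨{ toFun := v, map_mul' := hvmul, nonneg' := hvnn, eq_zero' := fun c => ?_,
            add_le' := fun c d => (hvadd c d).trans (max_le_add_of_nonneg (hvnn c) (hvnn d)) },
    hvadd, hv⟩
  change N (num c) / N (den c) = 0 ↔ c = 0
  rw [div_eq_zero_iff, or_iff_left (hN (hden c)), hker, ← hnum, mul_eq_zero,
    or_iff_left (hden c)]

end absoluteValue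

/-! ### Values of functions at points of affine open subsets, and charts. -/

namespace AlgebraicGeometry.Scheme

section evaluation

variable {X : Scheme.{u}}

theorem evaluation_res {U V : X.Opens} (h : V ≤ U) {y : X} (hy : y ∈ V) (f : Γ(X, U)) :
    X.evaluation V y hy (X.presheaf.map (homOfLE h).op f) = X.evaluation U y (h hy) f := by
  have := X.presheaf.germ_res (homOfLE h) y hy
  exact congrArg (fun θ => (θ ≫ X.residue y) f) this

/-- Near a point of an affine open subset `V`, a function on an open subset is a fraction of
functions on `V`. -/
theorem exists_evaluation_mul_eq {U V : X.Opens} (hV : IsAffineOpen V) {y : X} (hyU : y ∈ U)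
    (hyV : y ∈ V) (f : Γ(X, U)) :
    ∃ (g h : Γ(X, V)) (n : ℕ), y ∈ X.basicOpen g ∧ ∀ (y' : X) (hy'V : y' ∈ V),
      y' ∈ X.basicOpen g → ∃ hy' : y' ∈ U, X.evaluation U y' hy' f *
        X.evaluation V y' hy'V g ^ n = X.evaluation V y' hy'V h := by
  obtain ⟨g, hgU, hyg⟩ := hV.exists_basicOpen_le ⟨y, hyU⟩ hyV
  have := hV.isLocalization_basicOpen g
  obtain ⟨⟨h, ⟨_, n, rfl⟩⟩, hh⟩ := IsLocalization.surj (Submonoid.powers g)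
    (X.presheaf.map (homOfLE hgU).op f : Γ(X, X.basicOpen g))
  refine ⟨g, h, n, hyg, fun y' hy'V hy'g => ⟨hgU hy'g, ?_⟩⟩
  have e := congrArg (X.evaluation _ y' hy'g) hh
  change X.evaluation _ y' hy'g (_ * X.presheaf.map (homOfLE (X.basicOpen_le g)).op (g ^ n)) =
    X.evaluation _ y' hy'g (X.presheaf.map (homOfLE (X.basicOpen_le g)).op h) at e
  rwa [map_mul, evaluation_res, evaluation_res, evaluation_res, map_pow] at e

/-- An element of the residue field is the value of a function near `y`, which is locally a fraction
of functions on `V`. So the residue field consists of fractions of values from `V`. -/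
theorem exists_evaluation_fraction {V : X.Opens} (hV : IsAffineOpen V) {y : X} (hyV : y ∈ V)
    (c : X.residueField y) :
    ∃ a b : Γ(X, V), X.evaluation V y hyV b ≠ 0 ∧
      c * X.evaluation V y hyV b = X.evaluation V y hyV a := by
  obtain ⟨s, rfl⟩ := X.residue_surjective y c
  obtain ⟨U, hyU, f, rfl⟩ := X.presheaf.exists_germ_eq s
  obtain ⟨g, h, n, hg, H⟩ := exists_evaluation_mul_eq hV hyU hyV f
  obtain ⟨_, e⟩ := H y hyV hg
  refine ⟨h, g ^ n, ?_, ?_⟩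
  · rw [map_pow]
    exact pow_ne_zero n ((X.evaluation_ne_zero_iff_mem_basicOpen y hyV g).2 hg)
  · rw [map_pow]; exact e

theorem exists_point_of_prime {V : X.Opens} (hV : IsAffineOpen V) (P : PrimeSpectrum Γ(X, V)) :
    ∃ (y : X) (hy : y ∈ V), ∀ f, X.evaluation V y hy f = 0 ↔ f ∈ P.asIdeal := by
  have hy : hV.fromSpec P ∈ V := by
    have : hV.fromSpec P ∈ Set.range hV.fromSpec := ⟨P, rfl⟩
    rwa [hV.range_fromSpec] at this
  refine ⟨hV.fromSpec P, hy, fun f => ?_⟩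
  rw [evaluation_eq_zero_iff_notMem_basicOpen]
  have h1 : hV.fromSpec P ∈ X.basicOpen f ↔ P ∈ hV.fromSpec ⁻¹ᵁ X.basicOpen f := Iff.rfl
  rw [h1, hV.fromSpec_preimage_basicOpen]
  exact not_not

/-- The two points lie in the same principal open subsets of `V`, which form neighbourhood bases,
and a scheme is a T0 space. -/
theorem eq_of_evaluation_eq_zero_iff {V : X.Opens} (hV : IsAffineOpen V) {y y' : X} (hy : y ∈ V)
    (hy' : y' ∈ V) (h : ∀ f, X.evaluation V y hy f = 0 ↔ X.evaluation V y' hy' f = 0) :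
    y = y' := by
  have h' : ∀ f : Γ(X, V), y ∈ X.basicOpen f ↔ y' ∈ X.basicOpen f := fun f => by
    rw [← not_iff_not, ← evaluation_eq_zero_iff_notMem_basicOpen X y hy,
      ← evaluation_eq_zero_iff_notMem_basicOpen X y' hy', h]
  refine (inseparable_iff_forall_isOpen.2 fun O hO => ?_).eq
  constructor
  · intro hyO
    obtain ⟨f, hf, hyf⟩ := hV.exists_basicOpen_le (V := ⟨O, hO⟩) ⟨y, hyO⟩ hy
    exact hf ((h' f).1 hyf)
  · intro hyO
    obtain ⟨f, hf, hyf⟩ := hV.exists_basicOpen_le (V := ⟨O, hO⟩) ⟨y', hyO⟩ hy'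
    exact hf ((h' f).2 hyf)

end evaluation

section charts

variable {X : Scheme.{u}} {𝒰 : Set X.affineOpens}

/-- An intersection of charts need not be a chart, but it is covered by opens that are principal in
both. Such an open is principal in a member of `𝒰`, because principal opens of principal opens are
principal. -/
theorem PrincipalChart.exists_le_le (V W : X.PrincipalChart 𝒰) {y : X} (hV : y ∈ V.1)
    (hW : y ∈ W.1) : ∃ L : X.PrincipalChart 𝒰, L ≤ V ∧ L ≤ W ∧ y ∈ L.1 := by
  obtain ⟨f, g, hfg, hy⟩ := exists_basicOpen_le_affine_inter V.isAffineOpen W.isAffineOpen y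
    ⟨hV, hW⟩
  have hL : ∃ U ∈ 𝒰, ∃ f' : Γ(X, U.1), X.basicOpen f = X.basicOpen f' := by
    obtain ⟨V, U, hU, a, rfl⟩ := V
    obtain ⟨f', hf'⟩ := U.2.basicOpen_basicOpen_is_basicOpen a f
    exact ⟨U, hU, f', hf'.symm⟩
  exact ⟨⟨X.basicOpen f, hL⟩, ⟨f, rfl⟩, ⟨g, hfg⟩, hy⟩

theorem PrincipalChart.exists_mem (h𝒰 : ∀ y : X, ∃ U ∈ 𝒰, y ∈ U.1) (y : X) :
    ∃ V : X.PrincipalChart 𝒰, y ∈ V.1 := by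
  obtain ⟨U, hU, hy⟩ := h𝒰 y
  exact ⟨⟨U.1, U, hU, 1, by simp⟩, hy⟩

end charts

/-! ### Analytic points over an affine open subset and tropical points. -/

section berkovich

variable {X : Scheme.{u}} {k : Type u} [Field k] (π : X ⟶ Spec (CommRingCat.of k))
  (ν : SemiringValuation k TropicalReal)

theorem evaluation_scalars {V : X.Opens} {y : X} (hy : y ∈ V) (c : k) :
    X.evaluation V y hy (scalars π V c) = X.evaluation ⊤ y trivial (scalars π ⊤ c) := by
  rw [← map_scalars π (le_top : V ≤ ⊤), evaluation_res]

variable {π ν}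

/-- The functions of absolute value `0` determine the point of `X`; the absolute value on its
residue field is then determined by multiplicativity, since every element is a fraction of values.
-/
theorem BerkovichPoint.ext_of_abv_evaluation {V : X.Opens} (hV : IsAffineOpen V)
    {z z' : BerkovichPoint π ν} (hz : z.pt ∈ V) (hz' : z'.pt ∈ V)
    (h : ∀ f, z.abv (X.evaluation V _ hz f) = z'.abv (X.evaluation V _ hz' f)) : z = z' := by
  have hpt : z.pt = z'.pt := eq_of_evaluation_eq_zero_iff hV hz hz' fun f => by
    rw [← z.abv.eq_zero, h, z'.abv.eq_zero]
  obtain ⟨y, v, hv, hv'⟩ := z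
  obtain ⟨y', v', _, _⟩ := z'
  dsimp only at hpt hz hz' h
  subst hpt
  congr
  ext c
  obtain ⟨a, b, hb, hc⟩ := exists_evaluation_fraction hV hz c
  refine mul_right_cancel₀ (v.ne_zero hb) ?_
  rw [← map_mul, hc, h a, h b, ← map_mul, hc]

/-- The seminorm `N f = exp q(x_f)` has a prime kernel `P`. The point of `V` given by `P` has a
residue field of fractions, to which `N` extends. -/
theorem exists_berkovichPoint {V : X.Opens} (hV : IsAffineOpen V)
    (q : ScalarExt TropicalReal Γ(X, V) →ₐ[TropicalReal] TropicalReal)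
    (hq : ∀ f, ev π V f = 0 →
      F1Scheme.MaxAttainedTwice fun b => q (ν.toFun (f.coeff b) • ScalarExt.x b)) :
    ∃ (z : BerkovichPoint π ν) (hz : z.pt ∈ V),
      ∀ f, z.abv (X.evaluation V _ hz f) = (q (ScalarExt.x f)).exp := by
  let N : Γ(X, V) → ℝ := fun f => (q (ScalarExt.x f)).exp
  have hadd : ∀ a b, N (a + b) ≤ max (N a) (N b) := fun a b => by
    rw [← TropicalReal.exp_strictMono.monotone.map_max]
    exact TropicalReal.exp_strictMono.monotone
      (ScalarExt.apply_x_add_le ν (scalars π V) (ev π V) (ev_x π V) (ev_smul π V) q hq a b)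
  have hsc : ∀ c, N (scalars π V c) = (ν.toFun c).exp := fun c => congrArg TropicalReal.exp
    (ScalarExt.apply_x_scalar ν (scalars π V) (ev π V) (ev_x π V) (ev_smul π V) q hq c)
  have hmul : ∀ a b, N (a * b) = N a * N b := fun a b => by
    simp only [N]; rw [map_mul, map_mul, TropicalReal.exp_mul]
  have hone : N 1 = 1 := by simp only [N]; rw [map_one, map_one, TropicalReal.exp_one]
  have hzero : N 0 = 0 := by simp only [N]; rw [map_zero, map_zero, TropicalReal.exp_zero]
  have hnn : ∀ a, 0 ≤ N a := fun a => TropicalReal.exp_nonneg _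
  let P : Ideal Γ(X, V) :=
    { carrier := {a | N a = 0}
      zero_mem' := hzero
      add_mem' := fun {a b} (ha : N a = 0) (hb : N b = 0) =>
        le_antisymm ((hadd a b).trans (by rw [ha, hb, max_self])) (hnn _)
      smul_mem' := fun c a (ha : N a = 0) => by
        change N (c * a) = 0
        rw [hmul, ha, mul_zero] }
  have hP : P.IsPrime :=
    { ne_top' := fun h => one_ne_zero (hone.symm.trans ((Ideal.eq_top_iff_one P).1 h))
      mem_or_mem' := fun {a b} (h : N (a * b) = 0) => by
        rw [hmul] at h; exact mul_eq_zero.1 h }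
  obtain ⟨y, hy, hker⟩ := exists_point_of_prime hV ⟨P, hP⟩
  obtain ⟨v, hv, hvN⟩ := exists_absoluteValue_of_ultrametric (N := N)
    (ρ := (X.evaluation V y hy).hom) (exists_evaluation_fraction hV hy) hone hmul hadd hnn
    fun a => (hker a).symm
  refine ⟨⟨y, v, hv, fun c => ?_⟩, hy, hvN⟩
  rw [← evaluation_scalars π hy, ← hsc]
  exact hvN _

/-- The point `q` is the logarithm of `f ↦ |f(z)|`, extended from monomials by the universal
property. -/
theorem exists_tropicalPoint {V : X.Opens} (z : BerkovichPoint π ν) (hz : z.pt ∈ V) :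
    ∃ q : ScalarExt TropicalReal Γ(X, V) →ₐ[TropicalReal] TropicalReal,
      (∀ f, ev π V f = 0 →
        F1Scheme.MaxAttainedTwice fun b => q (ν.toFun (f.coeff b) • ScalarExt.x b)) ∧
      ∀ f, z.abv (X.evaluation V _ hz f) = (q (ScalarExt.x f)).exp := by
  choose g hg using fun f : Γ(X, V) =>
    TropicalReal.exists_exp_eq (z.abv.nonneg (X.evaluation V _ hz f))
  let g' : Γ(X, V) →*₀ TropicalReal :=
    { toFun := g
      map_zero' := TropicalReal.exp_injective (by
        rw [hg, map_zero, map_zero, TropicalReal.exp_zero])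
      map_one' := TropicalReal.exp_injective (by
        rw [hg, map_one, map_one, TropicalReal.exp_one])
      map_mul' := fun a b => TropicalReal.exp_injective (by
        rw [TropicalReal.exp_mul, hg, hg, hg, map_mul, map_mul]) }
  have hx : ∀ f, ScalarExt.lift (S := TropicalReal) g' (ScalarExt.x f) = g f :=
    ScalarExt.lift_x g'
  refine ⟨ScalarExt.lift g', ?_, fun f => by rw [hx, hg]⟩
  refine ScalarExt.maxAttainedTwice_of_ultrametric ν (scalars π V) (ev π V) (ev_x π V)
    (ev_smul π V) _ (fun a b => ?_) fun c => ?_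
  · rw [hx, hx, hx, ← TropicalReal.exp_strictMono.le_iff_le,
      TropicalReal.exp_strictMono.monotone.map_max, hg, hg, hg, map_add]
    exact z.nonarchimedean _ _
  · refine TropicalReal.exp_injective ?_
    rw [hx, hg, evaluation_scalars, z.extends_abs]

theorem universalEmbedding_con_zero_iff {𝒰 : Set X.affineOpens} (V : X.PrincipalChart 𝒰)
    (f : ScalarExt k Γ(X, V.1)) : (universalEmbedding 𝒰 π).con V f 0 ↔ ev π V.1 f = 0 := by
  change ev π V.1 f = ev π V.1 0 ↔ _
  rw [map_zero]

theorem BerkovichPoint.isOpen_pt_mem (U : X.Opens) : IsOpen {z : BerkovichPoint π ν | z.pt ∈ U} :=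
  TopologicalSpace.isOpen_generateFrom_of_mem (Or.inl ⟨U, rfl⟩)

theorem abv_evaluation_ne_zero_iff (z : BerkovichPoint π ν) {V : X.Opens} (hz : z.pt ∈ V)
    (g : Γ(X, V)) : z.abv (X.evaluation V _ hz g) ≠ 0 ↔ z.pt ∈ X.basicOpen g := by
  rw [← evaluation_ne_zero_iff_mem_basicOpen X z.pt hz, Ne, Ne, z.abv.eq_zero]

end berkovich

end AlgebraicGeometry.Scheme

/-! ### Comparison of the universal tropicalization with the analytification. -/

namespace AlgebraicGeometry.Scheme

section comparison

variable {k : Type u} [Field k] {ν : SemiringValuation k TropicalReal} {X : Scheme.{u}}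
  [IsIntegral X] {π : X ⟶ Spec (CommRingCat.of k)} {𝒰 : Set X.affineOpens}

/-- The universal tropicalization as a closed subscheme of `M(X) ×_{𝔽₁} 𝕋`. -/
noncomputable abbrev universalTropicalSubscheme (ν : SemiringValuation k TropicalReal)
    (π : X ⟶ Spec (CommRingCat.of k)) (𝒰 : Set X.affineOpens) :
    ((X.scalarRestriction 𝒰).baseChange TropicalReal).ClosedSubscheme :=
  (X.scalarRestriction 𝒰).tropicalization ν (universalEmbedding 𝒰 π)

/-- The tropical point `φ` of the patch over `V` corresponds to the point `z` of the
analytification. -/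
def Corresponds (V : X.PrincipalChart 𝒰)
    (φ : (universalTropicalization 𝒰 π ν).alg V →ₐ[TropicalReal] TropicalReal)
    (z : BerkovichPoint π ν) : Prop :=
  ∃ hV : z.pt ∈ V.1, ∀ f : Γ(X, V.1), z.abv (X.evaluation V.1 _ hV f) =
    (φ ((universalTropicalSubscheme ν π 𝒰).quotMap V
      (ScalarExt.x f))).exp

theorem respects_tropicalization_iff (V : X.PrincipalChart 𝒰)
    (q : ScalarExt TropicalReal Γ(X, V.1) →ₐ[TropicalReal] TropicalReal) :
    (∀ a b, (universalTropicalSubscheme ν π 𝒰).con V a b →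
      q a = q b) ↔
    ∀ f, (universalEmbedding 𝒰 π).con V f 0 →
      F1Scheme.MaxAttainedTwice fun b => q (ν.toFun (f.coeff b) • ScalarExt.x b) :=
  ScalarExt.bend_trop_le_iff q ν _

theorem exists_corresponds_left (V : X.PrincipalChart 𝒰)
    (φ : (universalTropicalization 𝒰 π ν).alg V →ₐ[TropicalReal] TropicalReal) :
    ∃ z, Corresponds V φ z :=
  exists_berkovichPoint V.isAffineOpen (φ.comp ((universalTropicalSubscheme ν π 𝒰).quotMap V))
    fun f hf => (respects_tropicalization_iff V _).1
      ((universalTropicalSubscheme ν π 𝒰).comp_quotMap_respects φ) f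
      ((universalEmbedding_con_zero_iff V f).2 hf)

theorem exists_corresponds_right (V : X.PrincipalChart 𝒰) (z : BerkovichPoint π ν)
    (hz : z.pt ∈ V.1) :
    ∃ φ : (universalTropicalization 𝒰 π ν).alg V →ₐ[TropicalReal] TropicalReal,
      Corresponds V φ z := by
  obtain ⟨q, hq, h⟩ := exists_tropicalPoint z hz
  exact ⟨(universalTropicalSubscheme ν π 𝒰).liftHom q ((respects_tropicalization_iff V q).2
    fun f hf => hq f ((universalEmbedding_con_zero_iff V f).1 hf)), hz, h⟩

theorem Corresponds.unique_left {V : X.PrincipalChart 𝒰}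
    {φ ψ : (universalTropicalization 𝒰 π ν).alg V →ₐ[TropicalReal] TropicalReal}
    {z : BerkovichPoint π ν} (h : Corresponds V φ z) (h' : Corresponds V ψ z) : φ = ψ := by
  obtain ⟨_, h⟩ := h
  obtain ⟨_, h'⟩ := h'
  refine (universalTropicalSubscheme ν π 𝒰).comp_quotMap_injective V ?_
  exact ScalarExt.algHom_ext fun f => TropicalReal.exp_injective ((h f).symm.trans (h' f))

theorem Corresponds.unique_right {V : X.PrincipalChart 𝒰}
    {φ : (universalTropicalization 𝒰 π ν).alg V →ₐ[TropicalReal] TropicalReal}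
    {z z' : BerkovichPoint π ν} (h : Corresponds V φ z) (h' : Corresponds V φ z') : z = z' := by
  obtain ⟨hz, h⟩ := h
  obtain ⟨hz', h'⟩ := h'
  exact BerkovichPoint.ext_of_abv_evaluation V.isAffineOpen hz hz' fun f =>
    (h f).trans (h' f).symm

theorem Corresponds.comp_res {V W : X.PrincipalChart 𝒰} (hVW : V ≤ W)
    {χ : (universalTropicalization 𝒰 π ν).alg V →ₐ[TropicalReal] TropicalReal}
    {z : BerkovichPoint π ν} (h : Corresponds V χ z) :
    Corresponds W (χ.comp ((universalTropicalization 𝒰 π ν).res hVW)) z := by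
  obtain ⟨hz, h⟩ := h
  refine ⟨PrincipalChart.le_opens hVW hz, fun f => ?_⟩
  rw [← evaluation_res (PrincipalChart.le_opens hVW) hz, h]
  refine congrArg (fun t => (χ t).exp) (congrArg ((universalTropicalSubscheme ν π 𝒰).quotMap V) ?_)
  exact (ScalarExt.map_x (S := TropicalReal) ((X.scalarRestriction 𝒰).res hVW) f).symm

/-- Restriction to a smaller chart does not change the analytic point. Conversely, charts around the
same analytic point share a smaller chart around it, and the tropical point there restricts to both.
-/
theorem Corresponds.point_eq_iff {V W : X.PrincipalChart 𝒰}
    {φ : (universalTropicalization 𝒰 π ν).alg V →ₐ[TropicalReal] TropicalReal}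
    {ψ : (universalTropicalization 𝒰 π ν).alg W →ₐ[TropicalReal] TropicalReal}
    {z z' : BerkovichPoint π ν} (h : Corresponds V φ z) (h' : Corresponds W ψ z') :
    (universalTropicalization 𝒰 π ν).point V φ = (universalTropicalization 𝒰 π ν).point W ψ ↔
      z = z' := by
  constructor
  · intro e
    obtain ⟨L, hLV, hLW, χ, hφ, hψ⟩ := SemiringScheme.point_eq_point_iff.1 e
    dsimp only at hLV hLW hφ hψ
    rw [← hφ] at h
    rw [← hψ] at h'
    obtain ⟨w, hw⟩ := exists_corresponds_left L χ
    exact (h.unique_right (hw.comp_res hLV)).trans ((hw.comp_res hLW).unique_right h')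
  · rintro rfl
    obtain ⟨L, hLV, hLW, hL⟩ := PrincipalChart.exists_le_le V W h.1 h'.1
    obtain ⟨χ, hχ⟩ := exists_corresponds_right L z hL
    exact SemiringScheme.point_eq_point_iff.2 ⟨L, hLV, hLW, χ,
      (hχ.comp_res hLV).unique_left h, (hχ.comp_res hLW).unique_left h'⟩

theorem exists_equiv_berkovichPoint (h𝒰 : ∀ y : X, ∃ U ∈ 𝒰, y ∈ U.1) :
    ∃ e : (universalTropicalization 𝒰 π ν).Points TropicalReal ≃ BerkovichPoint π ν,
      ∀ (V : X.PrincipalChart 𝒰) φ,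
        Corresponds V φ (e ((universalTropicalization 𝒰 π ν).point V φ)) := by
  -- The image of `p` is required to correspond to all representatives of `p` at once, which
  -- `Corresponds.point_eq_iff` makes possible.
  choose F hF using fun p : (universalTropicalization 𝒰 π ν).Points TropicalReal =>
    show ∃ z, ∀ V φ, p = (universalTropicalization 𝒰 π ν).point V φ → Corresponds V φ z by
      obtain ⟨V, φ, rfl⟩ := SemiringScheme.exists_point_eq p
      obtain ⟨z, hz⟩ := exists_corresponds_left V φ
      refine ⟨z, fun W ψ h => ?_⟩
      obtain ⟨z', hz'⟩ := exists_corresponds_left W ψ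
      rwa [(hz.point_eq_iff hz').1 h]
  refine ⟨Equiv.ofBijective F ⟨fun p q h => ?_, fun z => ?_⟩, fun V φ => hF _ V φ rfl⟩
  · obtain ⟨V, φ, rfl⟩ := SemiringScheme.exists_point_eq p
    obtain ⟨W, ψ, rfl⟩ := SemiringScheme.exists_point_eq q
    exact ((hF _ V φ rfl).point_eq_iff (hF _ W ψ rfl)).2 h
  · obtain ⟨V, hV⟩ := PrincipalChart.exists_mem h𝒰 z.pt
    obtain ⟨φ, hφ⟩ := exists_corresponds_right V z hV
    exact ⟨_, (hF _ V φ rfl).unique_right hφ⟩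

/-- Tropical functions on the patch over `V` are continuous on the analytification of `V`. -/
theorem continuous_exp_tropicalFunction (V : X.PrincipalChart 𝒰)
    (Φ : {z : BerkovichPoint π ν // z.pt ∈ V.1} →
      (universalTropicalization 𝒰 π ν).alg V →ₐ[TropicalReal] TropicalReal)
    (hΦ : ∀ z, Corresponds V (Φ z) z.1) (a : (universalTropicalization 𝒰 π ν).alg V) :
    Continuous fun z => (Φ z a).exp := by
  obtain ⟨a, rfl⟩ := (universalTropicalSubscheme ν π 𝒰).quotMap_surjective V a
  induction a using ScalarExt.induction with
  | zero => simp only [map_zero]; exact continuous_const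
  | add f g hf hg =>
    simp only [map_add, TropicalReal.exp_add]
    exact hf.max hg
  | single s f =>
    simp only [map_smul, smul_eq_mul, TropicalReal.exp_mul]
    refine continuous_const.mul ?_
    refine continuous_def.2 fun D hD => ?_
    refine ⟨{z | ∃ hz : z.pt ∈ V.1, z.abv (X.evaluation V.1 z.pt hz f) ∈ D},
      TopologicalSpace.isOpen_generateFrom_of_mem (Or.inr ⟨V.1, f, D, hD, rfl⟩), ?_⟩
    ext z
    obtain ⟨hz, h⟩ := hΦ z
    have hiff := iff_of_eq (congrArg (· ∈ D) (h f))
    exact ⟨fun ⟨_, hD⟩ => hiff.1 hD, fun hD => ⟨hz, hiff.2 hD⟩⟩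

/-- Over a patch, a point is outside `Z` if it violates one of the equations of `Z`. By continuity
of both sides it then does so in a neighbourhood, and the part of the analytification over a patch
is open. -/
theorem isClosed_image_points (h𝒰 : ∀ y : X, ∃ U ∈ 𝒰, y ∈ U.1)
    (e : (universalTropicalization 𝒰 π ν).Points TropicalReal ≃ BerkovichPoint π ν)
    (he : ∀ (V : X.PrincipalChart 𝒰) φ,
      Corresponds V φ (e ((universalTropicalization 𝒰 π ν).point V φ)))
    (Z : (universalTropicalization 𝒰 π ν).ClosedSubscheme) :
    IsClosed (e '' Z.points TropicalReal) := by
  rw [← isOpen_compl_iff, isOpen_iff_forall_mem_open]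
  intro z hz
  obtain ⟨V, hV⟩ := PrincipalChart.exists_mem h𝒰 z.pt
  choose Φ hΦ using fun w : {w : BerkovichPoint π ν // w.pt ∈ V.1} =>
    exists_corresponds_right V w.1 w.2
  have hmem : ∀ w, w.1 ∈ e '' Z.points TropicalReal ↔
      ∀ a b, Z.con V a b → Φ w a = Φ w b := fun w => by
    rw [← Z.point_mem_points_iff, ← (he V (Φ w)).unique_right (hΦ w), e.injective.mem_set_image]
  have hz' := mt (hmem ⟨z, hV⟩).2 hz
  push Not at hz'
  obtain ⟨a, b, hab, hne⟩ := hz'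
  have hopen : IsOpen {w | (Φ w a).exp ≠ (Φ w b).exp} :=
    isOpen_ne_fun (continuous_exp_tropicalFunction V Φ hΦ a)
      (continuous_exp_tropicalFunction V Φ hΦ b)
  refine ⟨Subtype.val '' {w | (Φ w a).exp ≠ (Φ w b).exp}, ?_,
    (BerkovichPoint.isOpen_pt_mem V.1).isOpenMap_subtype_val _ hopen,
    ⟨⟨z, hV⟩, TropicalReal.exp_injective.ne hne, rfl⟩⟩
  rintro _ ⟨w, hw, rfl⟩ hw'
  exact hw (congrArg TropicalReal.exp ((hmem w).1 hw' a b hab))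

/-- An open subset of the analytification is, on the patch over `V`, a union of sets that are given
by a tropical inequation. -/
theorem isSeparating_of_isOpen
    (e : (universalTropicalization 𝒰 π ν).Points TropicalReal → BerkovichPoint π ν)
    (he : ∀ (V : X.PrincipalChart 𝒰) φ,
      Corresponds V φ (e ((universalTropicalization 𝒰 π ν).point V φ)))
    (V : X.PrincipalChart 𝒰) {O : Set (BerkovichPoint π ν)} (hO : IsOpen O) :
    SemiringScheme.IsSeparating {φ | e ((universalTropicalization 𝒰 π ν).point V φ) ∈ O} := by
  let m : Γ(X, V.1) →*₀ (universalTropicalization 𝒰 π ν).alg V :=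
    ((universalTropicalSubscheme ν π 𝒰).quotMap V).toRingHom.toMonoidWithZeroHom.comp ScalarExt.x
  have hm : ∀ (φ : (universalTropicalization 𝒰 π ν).alg V →ₐ[TropicalReal] TropicalReal) f,
      (e ((universalTropicalization 𝒰 π ν).point V φ)).abv
        (X.evaluation V.1 _ (he V φ).1 f) = (φ (m f)).exp := fun φ f => (he V φ).2 f
  have hbasic : ∀ (φ : (universalTropicalization 𝒰 π ν).alg V →ₐ[TropicalReal] TropicalReal) g,
      φ (m g) ≠ φ 0 ↔
        (e ((universalTropicalization 𝒰 π ν).point V φ)).pt ∈ X.basicOpen g := fun φ g => by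
    rw [← abv_evaluation_ne_zero_iff _ (he V φ).1, hm, Ne, Ne, TropicalReal.exp_eq_zero, map_zero]
  -- Sets given by inequations are stable under unions and finite intersections, so only the two
  -- kinds of subbasic open sets matter.
  induction hO with
  | univ => exact SemiringScheme.isSeparating_univ
  | inter O O' _ _ h h' => exact h.inter h'
  | sUnion S _ h =>
    refine .of_local fun φ hφ => ?_
    obtain ⟨O, hO, hφO⟩ := hφ
    exact ⟨_, h O hO, hφO, fun ψ hψ => ⟨O, hO, hψ⟩⟩
  | basic O hO =>
    refine .of_local fun φ hφ => ?_
    rcases hO with ⟨U, rfl⟩ | ⟨U, f, D, hD, rfl⟩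
    · obtain ⟨g, hgU, hg⟩ := V.isAffineOpen.exists_basicOpen_le ⟨_, hφ⟩ (he V φ).1
      exact ⟨_, SemiringScheme.isSeparating_ne (m g) 0, (hbasic φ g).2 hg,
        fun ψ hψ => hgU ((hbasic ψ g).1 hψ)⟩
    · obtain ⟨hU, hφD⟩ := hφ
      obtain ⟨g, h, n, hg, H⟩ := exists_evaluation_mul_eq V.isAffineOpen hU (he V φ).1 f
      obtain ⟨δ, hδ, hball⟩ := Metric.isOpen_iff.1 hD _ hφD
      set r := (e ((universalTropicalization 𝒰 π ν).point V φ)).abv (X.evaluation U _ hU f)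
      have hr : 0 ≤ r := AbsoluteValue.nonneg _ _
      -- the absolute value of `f` in terms of `g` and `h`
      have key : ∀ ψ : (universalTropicalization 𝒰 π ν).alg V →ₐ[TropicalReal] TropicalReal,
          ψ (m g) ≠ ψ 0 →
          ∃ hψ : (e ((universalTropicalization 𝒰 π ν).point V ψ)).pt ∈ U,
            0 < (ψ (m g)).exp ^ n ∧
            (e ((universalTropicalization 𝒰 π ν).point V ψ)).abv (X.evaluation U _ hψ f) *
              (ψ (m g)).exp ^ n = (ψ (m h)).exp := fun ψ hψ => by
        obtain ⟨hψU, e1⟩ := H _ (he V ψ).1 ((hbasic ψ g).1 hψ)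
        refine ⟨hψU, pow_pos (lt_of_le_of_ne (TropicalReal.exp_nonneg _) ?_) n, ?_⟩
        · rw [ne_comm, Ne, TropicalReal.exp_eq_zero]; rwa [map_zero] at hψ
        · rw [← hm, ← hm, ← e1, map_mul, map_pow]
      -- Where `g ≠ 0`, `|f|` is `|h| / |g|^n`, so `r - δ < |f| < r + δ` is a pair of strict
      -- tropical inequalities between `h` and multiples of `g ^ n` by the scalars `log (r ± δ)`.
      obtain ⟨t, ht⟩ := TropicalReal.exists_exp_eq (add_nonneg hr hδ.le)
      have hexp : ∀ (s : TropicalReal)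
          (ψ : (universalTropicalization 𝒰 π ν).alg V →ₐ[TropicalReal] TropicalReal),
          (ψ (s • m g ^ n)).exp = s.exp * (ψ (m g)).exp ^ n := fun s ψ => by
        rw [map_smul, map_pow, smul_eq_mul, TropicalReal.exp_mul, TropicalReal.exp_pow]
      have hφg := (hbasic φ g).2 hg
      obtain ⟨hφU, hpos, hφh⟩ := key φ hφg
      have upper : φ (m h) < φ (t • m g ^ n) := by
        rw [← TropicalReal.exp_strictMono.lt_iff_lt, hexp, ← hφh, ht]
        exact mul_lt_mul_of_pos_right (lt_add_of_pos_right r hδ) hpos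
      have hsep := (SemiringScheme.isSeparating_ne (m g) 0).inter
        (SemiringScheme.isSeparating_lt (m h) (t • m g ^ n))
      have hup : ∀ ψ : (universalTropicalization 𝒰 π ν).alg V →ₐ[TropicalReal] TropicalReal,
          ψ (m h) < ψ (t • m g ^ n) → ∀ s, 0 < (ψ (m g)).exp ^ n →
            s * (ψ (m g)).exp ^ n = (ψ (m h)).exp → s < r + δ := fun ψ hψ s hp hs => by
        rw [← TropicalReal.exp_strictMono.lt_iff_lt, hexp, ht, ← hs] at hψ
        exact lt_of_mul_lt_mul_right hψ hp.le
      -- If `r - δ` is negative, it has no tropical logarithm, but the lower bound then holds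
      -- automatically.
      by_cases hrδ : r < δ
      · refine ⟨_, hsep, ⟨hφg, upper⟩, ?_⟩
        rintro ψ ⟨hψg, hψ⟩
        obtain ⟨hψU, hp, hψh⟩ := key ψ hψg
        refine ⟨hψU, hball ?_⟩
        rw [Metric.mem_ball, Real.dist_eq, abs_lt]
        have h1 := hup ψ hψ _ hp hψh
        have h2 := (e ((universalTropicalization 𝒰 π ν).point V ψ)).abv.nonneg
          (X.evaluation U _ hψU f)
        constructor <;> linarith
      · obtain ⟨t', ht'⟩ := TropicalReal.exists_exp_eq (sub_nonneg.2 (not_lt.1 hrδ))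
        have lower : φ (t' • m g ^ n) < φ (m h) := by
          rw [← TropicalReal.exp_strictMono.lt_iff_lt, hexp, ← hφh, ht']
          exact mul_lt_mul_of_pos_right (sub_lt_self r hδ) hpos
        refine ⟨_, hsep.inter (SemiringScheme.isSeparating_lt (t' • m g ^ n) (m h)),
          ⟨⟨hφg, upper⟩, lower⟩, ?_⟩
        rintro ψ ⟨⟨hψg, hψ⟩, hψ'⟩
        obtain ⟨hψU, hp, hψh⟩ := key ψ hψg
        refine ⟨hψU, hball ?_⟩
        rw [Metric.mem_ball, Real.dist_eq, abs_lt]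
        have h1 := hup ψ hψ _ hp hψh
        have h2 : ψ (t' • m g ^ n) < ψ (m h) := hψ'
        rw [← TropicalReal.exp_strictMono.lt_iff_lt, hexp, ht', ← hψh] at h2
        have h3 := lt_of_mul_lt_mul_right h2 hp.le
        constructor <;> linarith

/-- The subscheme is cut out by all equations that hold on the preimage of `C`; as the complement of
`C` is separating on each patch, no further points satisfy them. -/
theorem exists_points_eq_preimage
    (e : (universalTropicalization 𝒰 π ν).Points TropicalReal → BerkovichPoint π ν)
    (he : ∀ (V : X.PrincipalChart 𝒰) φ,
      Corresponds V φ (e ((universalTropicalization 𝒰 π ν).point V φ)))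
    {C : Set (BerkovichPoint π ν)} (hC : IsClosed C) :
    ∃ Z : (universalTropicalization 𝒰 π ν).ClosedSubscheme, e ⁻¹' C = Z.points TropicalReal := by
  refine ⟨SemiringScheme.vanishing (fun _ => TropicalReal.isUnit_of_ne_zero) (e ⁻¹' C),
    (SemiringScheme.subset_points_vanishing _ _).antisymm
      (SemiringScheme.points_vanishing_subset _ fun V φ hφ => ?_)⟩
  obtain ⟨a, b, hne, H⟩ := isSeparating_of_isOpen e he V hC.isOpen_compl φ hφ
  exact ⟨a, b, hne, fun ψ hψ => by_contra fun h => H ψ h hψ⟩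

end comparison

end AlgebraicGeometry.Scheme

/-- The universal tropicalization of an integral scheme `X` over a non-archimedean valued field
`(k, ν)`, formed with an arbitrary affine open covering `𝒰` of `X`.
* Its tropical points are those of the set-theoretic tropicalization of `X` in `M(X) ×_{𝔽₁} k`.
* There is a unique homeomorphism from its tropical points, with the strong Zariski topology, to the
  Berkovich analytification that sends a tropical point `φ` of the patch over `V` to the
  point `z` over `V` with `|f(z)| = exp (φ (x_f))` for all functions `f` on `V`.
* The closed sets of the strong Zariski topology are exactly the sets of tropical points of closed
  subschemes. -/
theorem theoremA {k : Type u} [Field k] (ν : SemiringValuation k TropicalReal)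
    (X : Scheme.{u}) [IsIntegral X] (π : X ⟶ Spec (CommRingCat.of k))
    (𝒰 : Set X.affineOpens) (h𝒰 : ∀ y : X, ∃ U ∈ 𝒰, y ∈ U.1) :
    (Function.Injective (((X.scalarRestriction 𝒰).tropicalization ν
        (Scheme.universalEmbedding 𝒰 π)).incl TropicalReal) ∧
      Set.range (((X.scalarRestriction 𝒰).tropicalization ν
        (Scheme.universalEmbedding 𝒰 π)).incl TropicalReal) =
      (X.scalarRestriction 𝒰).setTropicalization ν (Scheme.universalEmbedding 𝒰 π)) ∧
    (∃! e : (Scheme.universalTropicalization 𝒰 π ν).Points TropicalReal ≃ₜ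
        Scheme.BerkovichPoint π ν,
      ∀ (V : X.PrincipalChart 𝒰)
        (φ : (Scheme.universalTropicalization 𝒰 π ν).alg V →ₐ[TropicalReal] TropicalReal),
        ∃ hV : (e ((Scheme.universalTropicalization 𝒰 π ν).point V φ)).pt ∈ V.1,
          ∀ f : Γ(X, V.1),
            (e ((Scheme.universalTropicalization 𝒰 π ν).point V φ)).abv
                (X.evaluation V.1 _ hV f) =
              (φ (((X.scalarRestriction 𝒰).tropicalization ν
                (Scheme.universalEmbedding 𝒰 π)).quotMap V (ScalarExt.x f))).exp) ∧
    (∀ C : Set ((Scheme.universalTropicalization 𝒰 π ν).Points TropicalReal),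
      IsClosed C ↔
        ∃ Z : (Scheme.universalTropicalization 𝒰 π ν).ClosedSubscheme,
          C = Z.points TropicalReal) := by
  refine ⟨⟨SemiringScheme.ClosedSubscheme.incl_injective _, ?_⟩, ?_⟩
  · ext p
    constructor
    · rintro ⟨p, rfl⟩
      obtain ⟨V, φ, rfl⟩ := SemiringScheme.exists_point_eq p
      exact ⟨V, _, rfl, (Scheme.respects_tropicalization_iff V _).1
        (SemiringScheme.ClosedSubscheme.comp_quotMap_respects _ φ)⟩
    · rintro ⟨V, q, rfl, hq⟩
      exact (SemiringScheme.ClosedSubscheme.point_mem_points_iff _).2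
        ((Scheme.respects_tropicalization_iff V q).2 hq)
  obtain ⟨e, he⟩ := Scheme.exists_equiv_berkovichPoint (ν := ν) (π := π) h𝒰
  -- One direction needs only the generating sets. In the other direction, every Berkovich open set
  -- already pulls back to a generating set, so the sets `Z(𝕋)` are all the closed sets and not
  -- merely a subbasis.
  have hopen : ∀ O : Set ((Scheme.universalTropicalization 𝒰 π ν).Points TropicalReal),
      IsOpen O ↔ IsOpen (e.symm ⁻¹' O) := fun O => by
    constructor
    · intro hO
      induction hO with
      | univ => exact isOpen_univ
      | inter O O' _ _ h h' => exact h.inter h'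
      | sUnion S _ h =>
        rw [Set.preimage_sUnion]
        exact isOpen_biUnion h
      | basic O hO =>
        obtain ⟨Z, rfl⟩ := hO
        rw [Set.preimage_compl, isOpen_compl_iff, ← e.image_eq_preimage_symm]
        exact Scheme.isClosed_image_points h𝒰 e he Z
    · intro hO
      obtain ⟨Z, hZ⟩ := Scheme.exists_points_eq_preimage e he hO.isClosed_compl
      refine TopologicalSpace.isOpen_generateFrom_of_mem ⟨Z, ?_⟩
      rw [← hZ, Set.preimage_compl, compl_compl, ← Set.preimage_comp, e.symm_comp_self,
        Set.preimage_id]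
  let E : (Scheme.universalTropicalization 𝒰 π ν).Points TropicalReal ≃ₜ
      Scheme.BerkovichPoint π ν :=
    { e with
      continuous_toFun := continuous_def.2 fun O hO => (hopen _).2 (by
        change IsOpen (e.symm ⁻¹' (e ⁻¹' O))
        rwa [← Set.preimage_comp, e.self_comp_symm, Set.preimage_id])
      continuous_invFun := continuous_def.2 fun O hO => (hopen O).1 hO }
  refine ⟨⟨E, he, fun E' hE' => ?_⟩, fun C => ⟨fun hC => ?_, ?_⟩⟩
  -- Every tropical point lies on a patch, and there it corresponds to only one analytic point.
  · ext p : 1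
    obtain ⟨V, φ, rfl⟩ := SemiringScheme.exists_point_eq p
    exact Scheme.Corresponds.unique_right (hE' V φ) (he V φ)
  · obtain ⟨Z, hZ⟩ := Scheme.exists_points_eq_preimage e he (E.isClosed_image.2 hC)
    exact ⟨Z, by rw [← hZ]; exact (e.preimage_image C).symm⟩
  · rintro ⟨Z, rfl⟩
    exact isOpen_compl_iff.1 (TopologicalSpace.isOpen_generateFrom_of_mem ⟨Z, rfl⟩)
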